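/- Let $(X,d)$ be a nonempty metric space with a Borel measure $\mu$ such that, with $V(x,r):=\mu(B(x,r))$, one has $0<V(x,r)<\infty$ for all $x\in X$, $r>0$, and suppose that $X$ is doubling: there is $C\ge 1$ with $V(x,2r)\le C\,V(x,r)$ for all $x\in X$, $r>0$. Let $X^+:=X\times(0,\infty)$ carry the measure $d\mu(y)\,\frac{dt}{t}$, and let $L^0(X^+)$ be the space of complex measurable functions on $X^+$ modulo almost everywhere equality. Put $\Gamma(x):=\{(y,t)\in X^+: y\in B(x,t)\}$ for $x\in X$, $T(B):=\{(y,t)\in X^+: B(y,t)\subset B\}$ for a ball $B\subset X$, and $(V^{r}f)(y,t):=V(y,t)^{r}f(y,t)$ for $r\in\mathbb R$. For $0<p,q<\infty$ and $s\in\mathbb R$ let $T^{p,q}_s$ be the space of $f\in L^0(X^+)$ with $$\|f\|_{T^{p,q}_s}:=\Big(\int_X\Big(\iint_{\Gamma(x)}|V^{-s}f(y,t)|^q\,\frac{d\mu(y)}{V(y,t)}\frac{dt}{t}\Big)^{p/q}d\mu(x)\Big)^{1/p}<\infty .$$ For $0<q<\infty$ and $s,\alpha\in\mathbb R$ let $T^{\infty,q}_{s;\alpha}$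 be the space of $f\in L^0(X^+)$ with $$\|f\|_{T^{\infty,q}_{s;\alpha}}:=\operatorname*{ess\,sup}_{x\in X}\ \sup_{B\ni x}\frac1{\mu(B)^{\alpha}}\Big(\frac1{\mu(B)}\iint_{T(B)}|V^{-s}f(y,t)|^q\,d\mu(y)\frac{dt}{t}\Big)^{1/q}<\infty ,$$ the supremum being over all balls $B$ containing $x$; for $q=\infty$ the inner expression is replaced by $\mu(B)^{-\alpha}\operatorname{ess\,sup}_{T(B)}|V^{-s}f|$. Theorem. Let $p\in(0,1)$, $q\in[1,\infty)$, $\frac1q+\frac1{q'}=1$ (so $q'=\infty$ if $q=1$), and $s\in\mathbb R$. Then the $L^2(X^+)$ inner product $$\langle f,g\rangle:=\iint_{X^+}f(x,t)\,\overline{g(x,t)}\,d\mu(x)\frac{dt}{t}$$ identifies the dual of $T^{p,q}_s$ with $T^{\infty,q'}_{-s;\,1/p-1}$. That is: the integral converges absolutely for all $f\in T^{p,q}_s$ and $g\in T^{\infty,q'}_{-s;1/p-1}$; the map $g\mapsto\langle\,\cdot\,,g\rangle$ is a conjugate-linear bijection from $T^{\infty,q'}_{-s;1/p-1}$ onto the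 space of bounded linear functionals on $T^{p,q}_s$; and there is a finite constant $C$ such that $$\|\langle\,\cdot\,,g\rangle\|\le C\,\|g\|_{T^{\infty,q'}_{-s;1/p-1}}\quad\text{and}\quad \|g\|_{T^{\infty,q'}_{-s;1/p-1}}\le C\,\|\langle\,\cdot\,,g\rangle\|$$ for all $g\in T^{\infty,q'}_{-s;1/p-1}$, where $\|\varphi\|:=\sup\{|\varphi(f)|:\|f\|_{T^{p,q}_s}\le1\}$. -/

import Mathlib

open MeasureTheory Set Metric
open scoped ENNReal NNReal ComplexConjugate

noncomputable section

namespace TentSpace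

variable {X : Type*} [MetricSpace X] [MeasurableSpace X]

/-- Nondegeneracy of a metric measure space: `0 < V(x,r) < ∞` for all `x` and all `r > 0`. -/
class Nondegenerate (μ : Measure X) : Prop where
  pos : ∀ (x : X) (r : ℝ), 0 < r → 0 < μ (ball x r)
  lt_top : ∀ (x : X) (r : ℝ), 0 < r → μ (ball x r) < ∞

/-- The doubling condition `V(x,2r) ≤ C V(x,r)`. -/
def Doubling (μ : Measure X) : Prop :=
  ∃ C : ℝ≥0, 1 ≤ C ∧ ∀ (x : X) (r : ℝ), 0 < r → μ (ball x (2 * r)) ≤ C * μ (ball x r)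

/-- The measure `dμ(y) dt/t` of the half-space `X⁺ = X × (0,∞)`. It is carried by `X × ℝ` and gives
no mass to `{t ≤ 0}`, so that functions on `X × ℝ` modulo almost everywhere equality are functions
on `X⁺` modulo almost everywhere equality. -/
def halfMeasure (μ : Measure X) : Measure (X × ℝ) :=
  μ.prod ((volume.restrict (Ioi (0 : ℝ))).withDensity fun t => ENNReal.ofReal t⁻¹)

/-- `L⁰(X⁺)`: complex measurable functions on the half-space, modulo almost everywhere equality. -/
abbrev L0 (μ : Measure X) : Type _ := (X × ℝ) →ₘ[halfMeasure μ] ℂ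

/-- The cone `Γ(x) = {(y,t) : y ∈ B(x,t)}`; its points have `t > 0` automatically. -/
def cone (x : X) : Set (X × ℝ) := {z | z.1 ∈ ball x z.2}

/-- The tent `T(B) = {(y,t) ∈ X⁺ : B(y,t) ⊆ B}`. -/
def tent (B : Set X) : Set (X × ℝ) := {z | 0 < z.2 ∧ ball z.1 z.2 ⊆ B}

/-- The operator `(V^s f)(y,t) = V(y,t)^s f(y,t)`. -/
def volPow (μ : Measure X) (s : ℝ) (f : X × ℝ → ℂ) : X × ℝ → ℂ :=
  fun z => ((μ.real (ball z.1 z.2) ^ s : ℝ) : ℂ) * f z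

/-- The measure `V(y,t)⁻¹ dμ(y) dt/t` on the half-space. -/
def coneMeasure (μ : Measure X) : Measure (X × ℝ) :=
  (halfMeasure μ).withDensity fun z => (μ (ball z.1 z.2))⁻¹

/-- The Lusin functional `A^q f(x)`, that is `(∬_{Γ(x)} |f(y,t)|^q V(y,t)⁻¹ dμ(y) dt/t)^{1/q}` for
`0 < q < ∞` and the essential supremum of `|f|` on `Γ(x)` for `q = ∞`. -/
def lusin (μ : Measure X) (q : ℝ≥0∞) (f : X × ℝ → ℂ) (x : X) : ℝ≥0∞ :=
  eLpNorm f q ((coneMeasure μ).restrict (cone x))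

/-- The Carleson functional: `C^q_α f(x)` is the supremum over all balls `B ∋ x` of
`μ(B)^{-α} (μ(B)⁻¹ ∬_{T(B)} |f(y,t)|^q dμ(y) dt/t)^{1/q}` for `0 < q < ∞`, and of
`μ(B)^{-α} ess sup_{T(B)} |f|` for `q = ∞`. -/
def carleson (μ : Measure X) (q : ℝ≥0∞) (α : ℝ) (f : X × ℝ → ℂ) (x : X) : ℝ≥0∞ :=
  ⨆ (c : X) (r : ℝ) (_ : 0 < r) (_ : x ∈ ball c r),
    μ (ball c r) ^ (-α) *
      eLpNorm f q ((μ (ball c r))⁻¹ • (halfMeasure μ).restrict (tent (ball c r)))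

/-- The quasi-norm `‖f‖_{T^{p,q}_s} = ‖A^q (V^{-s} f)‖_{L^p(X)}`. -/
def tentNorm (μ : Measure X) (p q : ℝ≥0∞) (s : ℝ) (f : L0 μ) : ℝ≥0∞ :=
  eLpNorm (lusin μ q (volPow μ (-s) f)) p μ

/-- The quasi-norm `‖f‖_{T^{∞,q}_{s;α}} = ‖C^q_α (V^{-s} f)‖_{L^∞(X)}`. -/
def carlesonNorm (μ : Measure X) (q : ℝ≥0∞) (s α : ℝ) (f : L0 μ) : ℝ≥0∞ :=
  eLpNorm (carleson μ q α (volPow μ (-s) f)) ∞ μ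

/-! ### Facts that make the two spaces linear subspaces of `L⁰(X⁺)` -/

theorem volPow_add {μ : Measure X} (s : ℝ) (f g : L0 μ) :
    volPow μ s ⇑(f + g) =ᵐ[halfMeasure μ] volPow μ s f + volPow μ s g := by
  filter_upwards [AEEqFun.coeFn_add f g] with z hz
  simp only [volPow, hz, Pi.add_apply, mul_add]

theorem volPow_smul {μ : Measure X} (s : ℝ) (c : ℂ) (f : L0 μ) :
    volPow μ s ⇑(c • f) =ᵐ[halfMeasure μ] c • volPow μ s f := by
  filter_upwards [AEEqFun.coeFn_smul c f] with z hz
  simp only [volPow, hz, Pi.smul_apply, smul_eq_mul]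
  ring

theorem volPow_zero {μ : Measure X} (s : ℝ) :
    volPow μ s ⇑(0 : L0 μ) =ᵐ[halfMeasure μ] 0 := by
  filter_upwards [AEEqFun.coeFn_zero (α := X × ℝ) (β := ℂ) (μ := halfMeasure μ)] with z hz
  simp [volPow, hz]

theorem restrict_coneMeasure_ac (μ : Measure X) (x : X) :
    (coneMeasure μ).restrict (cone x) ≪ halfMeasure μ :=
  Measure.restrict_le_self.absolutelyContinuous.trans (withDensity_absolutelyContinuous _ _)

theorem smul_restrict_ac {Ω : Type*} [MeasurableSpace Ω] (m : Measure Ω) (a : ℝ≥0∞) (S : Set Ω) :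
    a • m.restrict S ≪ m :=
  Measure.smul_absolutelyContinuous.trans Measure.restrict_le_self.absolutelyContinuous

theorem lusin_congr {μ : Measure X} {q : ℝ≥0∞} {f g : X × ℝ → ℂ} (h : f =ᵐ[halfMeasure μ] g) :
    lusin μ q f = lusin μ q g :=
  funext fun x => eLpNorm_congr_ae ((restrict_coneMeasure_ac μ x).ae_eq h)

theorem carleson_congr {μ : Measure X} {q : ℝ≥0∞} {α : ℝ} {f g : X × ℝ → ℂ}
    (h : f =ᵐ[halfMeasure μ] g) : carleson μ q α f = carleson μ q α g := by
  funext x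
  refine iSup_congr fun c => iSup_congr fun r => iSup_congr fun _ => iSup_congr fun _ => ?_
  rw [eLpNorm_congr_ae ((smul_restrict_ac (halfMeasure μ) _ _).ae_eq h)]

/-- Continuity from below of `L^q` norms along an increasing sequence of sets. -/
theorem exists_lt_eLpNorm_restrict {Ω : Type*} [MeasurableSpace Ω] (m : Measure Ω) (q : ℝ≥0∞)
    (f : Ω → ℂ) (S : ℕ → Set Ω) (hS : Monotone S) (a : ℝ≥0∞)
    (h : a < eLpNorm f q (m.restrict (⋃ n, S n))) :
    ∃ n, a < eLpNorm f q (m.restrict (S n)) := by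
  by_contra! hle
  refine absurd h (not_lt.2 ?_)
  rcases eq_or_ne q 0 with rfl | hq0
  · simp
  rcases eq_or_ne q ∞ with rfl | hq
  · rw [eLpNorm_exponent_top]
    refine essSup_le_of_ae_le a ?_
    refine (ae_restrict_iUnion_iff S _).2 fun n => ?_
    have := hle n
    rw [eLpNorm_exponent_top] at this
    filter_upwards [ae_le_eLpNormEssSup (f := f) (μ := m.restrict (S n))] with z hz
    exact hz.trans this
  · have hq' : 0 < q.toReal := ENNReal.toReal_pos hq0 hq
    simp only [eLpNorm_eq_lintegral_rpow_enorm_toReal hq0 hq, one_div] at hle ⊢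
    rw [setLIntegral_iUnion_of_directed _ hS.directed_le, ENNReal.rpow_inv_le_iff hq']
    exact iSup_le fun n => (ENNReal.rpow_inv_le_iff hq').1 (hle n)

theorem lowerSemicontinuous_lusin (μ : Measure X) (q : ℝ≥0∞) (f : X × ℝ → ℂ) :
    LowerSemicontinuous (lusin μ q f) := by
  intro x a ha
  have hcone : cone x = ⋃ n : ℕ, {z : X × ℝ | dist z.1 x < z.2 - 1 / ((n : ℝ) + 1)} := by
    ext z
    simp only [cone, mem_ball, mem_ofPred_eq, mem_iUnion]
    constructor
    · intro h
      obtain ⟨n, hn⟩ := exists_nat_one_div_lt (sub_pos.2 h)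
      exact ⟨n, by linarith⟩
    · rintro ⟨n, hn⟩
      have : (0 : ℝ) < 1 / ((n : ℝ) + 1) := by positivity
      linarith
  rw [lusin, hcone] at ha
  obtain ⟨n, hn⟩ := exists_lt_eLpNorm_restrict _ q f _ (by
    intro m n hmn z hz
    have : 1 / ((n : ℝ) + 1) ≤ 1 / ((m : ℝ) + 1) := by gcongr
    simp only [mem_ofPred_eq] at hz ⊢
    linarith) a ha
  filter_upwards [ball_mem_nhds x (show (0 : ℝ) < 1 / ((n : ℝ) + 1) by positivity)] with x' hx'
  refine hn.trans_le (eLpNorm_mono_measure _ (Measure.restrict_mono ?_ le_rfl))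
  intro z hz
  simp only [cone, mem_ball, mem_ofPred_eq] at hz hx' ⊢
  have := dist_triangle z.1 x x'
  rw [dist_comm x x'] at this
  linarith

theorem sigmaFinite_of_nondegenerate (μ : Measure X) [hμ : Nondegenerate μ] : SigmaFinite μ := by
  rcases isEmpty_or_nonempty X with h | ⟨⟨x₀⟩⟩
  · rw [Measure.eq_zero_of_isEmpty μ]; infer_instance
  · exact ⟨⟨⟨fun n => ball x₀ (n + 1), fun _ => trivial,
      fun n => hμ.lt_top x₀ _ (by positivity), by
        refine eq_univ_of_forall fun x => mem_iUnion.2 ?_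
        obtain ⟨n, hn⟩ := exists_nat_gt (dist x x₀)
        exact ⟨n, by rw [mem_ball]; linarith⟩⟩⟩⟩

theorem secondCountable_of_nondegenerate [BorelSpace X] (μ : Measure X) [hμ : Nondegenerate μ] :
    SecondCountableTopology X := by
  have := sigmaFinite_of_nondegenerate μ
  refine Metric.secondCountable_of_almost_dense_set fun ε hε => ?_
  obtain ⟨N, hN⟩ : ∃ N, Maximal (fun N : Set X => N.Pairwise fun x y => ε < dist x y) N := by
    refine zorn_subset _ fun c hc hchain => ⟨⋃₀ c, ?_, fun s hs => subset_sUnion_of_mem hs⟩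
    exact (pairwise_sUnion hchain.directedOn).2 fun s hs => hc hs
  refine ⟨N, ?_, fun x => ?_⟩
  · have h := Measure.countable_meas_pos_of_disjoint_iUnion (μ := μ)
      (As := fun x : N => ball (x : X) (ε / 2)) (fun _ => measurableSet_ball) (by
        intro x y hxy
        refine ball_disjoint_ball ?_
        have := hN.1 x.2 y.2 (fun h => hxy (Subtype.ext h))
        linarith)
    have h' : {i : N | 0 < μ (ball (i : X) (ε / 2))} = univ :=
      eq_univ_of_forall fun i => hμ.pos _ _ (by positivity)
    rw [h'] at h
    exact countable_coe_iff.1 (countable_univ_iff.1 h)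
  · by_contra! hx
    have hins : (insert x N).Pairwise fun x y => ε < dist x y := by
      refine hN.1.insert fun y hy _ => ⟨hx y hy, ?_⟩
      rw [dist_comm]; exact hx y hy
    have hxN : x ∈ N := hN.2 hins (subset_insert x N) (mem_insert x N)
    have := hx x hxN
    rw [dist_self] at this
    linarith

theorem measurable_volume_ball [BorelSpace X] (μ : Measure X) [Nondegenerate μ] :
    Measurable fun z : X × ℝ => μ (ball z.1 z.2) := by
  have := sigmaFinite_of_nondegenerate μ
  have := secondCountable_of_nondegenerate μ
  have hs : MeasurableSet {w : (X × ℝ) × X | dist w.2 w.1.1 < w.1.2} :=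
    measurableSet_lt (by fun_prop) (by fun_prop)
  exact measurable_measure_prodMk_left hs

theorem aestronglyMeasurable_volPow [BorelSpace X] {μ : Measure X} [Nondegenerate μ] (s : ℝ)
    (f : L0 μ) :
    AEStronglyMeasurable (volPow μ s f) (halfMeasure μ) := by
  have h : Measurable fun z : X × ℝ => ((μ.real (ball z.1 z.2) ^ s : ℝ) : ℂ) :=
    Complex.measurable_ofReal.comp ((measurable_volume_ball μ).ennreal_toReal.pow_const s)
  exact h.aestronglyMeasurable.mul f.aestronglyMeasurable

theorem tentNorm_add_le [BorelSpace X] {μ : Measure X} [Nondegenerate μ] (p q : ℝ≥0∞) (s : ℝ)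
    (f g : L0 μ) :
    tentNorm μ p q s (f + g) ≤
      ENNReal.LpAddConst q * (ENNReal.LpAddConst p * (tentNorm μ p q s f + tentNorm μ p q s g)) := by
  have hm : ∀ f : L0 μ, AEStronglyMeasurable (lusin μ q (volPow μ (-s) f)) μ := fun f =>
    (lowerSemicontinuous_lusin μ q _).measurable.aestronglyMeasurable
  have hC : ENNReal.LpAddConst q ≠ ∞ := (ENNReal.LpAddConst_lt_top q).ne
  refine le_trans ?_ (mul_le_mul_right (eLpNorm_add_le' (hm f) (hm g) p) _)
  rw [tentNorm, lusin_congr (volPow_add (-s) f g), ← ENNReal.coe_toNNReal hC]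
  refine eLpNorm_le_nnreal_smul_eLpNorm_of_ae_le_mul' (.of_forall fun x => ?_) p
  simp only [enorm_eq_self, Pi.add_apply, ENNReal.coe_toNNReal hC]
  exact eLpNorm_add_le'
    ((aestronglyMeasurable_volPow (-s) f).mono_ac (restrict_coneMeasure_ac μ x))
    ((aestronglyMeasurable_volPow (-s) g).mono_ac (restrict_coneMeasure_ac μ x)) q

theorem tentNorm_smul_le {μ : Measure X} (p q : ℝ≥0∞) (s : ℝ) (c : ℂ) (f : L0 μ) :
    tentNorm μ p q s (c • f) ≤ ‖c‖ₑ * tentNorm μ p q s f := by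
  rw [tentNorm, lusin_congr (volPow_smul (-s) c f)]
  refine eLpNorm_le_nnreal_smul_eLpNorm_of_ae_le_mul' (.of_forall fun x => ?_) p
  simp only [enorm_eq_self]
  exact eLpNorm_const_smul_le

theorem tentNorm_zero (μ : Measure X) (p q : ℝ≥0∞) (s : ℝ) : tentNorm μ p q s 0 = 0 := by
  have h : lusin μ q (volPow μ (-s) (0 : L0 μ)) = 0 := by
    rw [lusin_congr (volPow_zero (-s))]
    funext x
    simp [lusin]
  rw [tentNorm, h, eLpNorm_zero]

theorem carlesonNorm_add_le [BorelSpace X] {μ : Measure X} [Nondegenerate μ] (q : ℝ≥0∞)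
    (s α : ℝ) (f g : L0 μ) :
    carlesonNorm μ q s α (f + g) ≤
      ENNReal.LpAddConst q * (carlesonNorm μ q s α f + carlesonNorm μ q s α g) := by
  have hC : ENNReal.LpAddConst q ≠ ∞ := (ENNReal.LpAddConst_lt_top q).ne
  simp only [carlesonNorm, eLpNorm_exponent_top]
  refine le_trans ?_ (mul_le_mul_right (eLpNormEssSup_add_le (μ := μ)
    (f := carleson μ q α (volPow μ (-s) f)) (g := carleson μ q α (volPow μ (-s) g))) _)
  rw [carleson_congr (volPow_add (-s) f g), ← ENNReal.coe_toNNReal hC]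
  simp only [← eLpNorm_exponent_top]
  refine eLpNorm_le_nnreal_smul_eLpNorm_of_ae_le_mul' (.of_forall fun x => ?_) ∞
  simp only [enorm_eq_self, Pi.add_apply, ENNReal.coe_toNNReal hC]
  refine iSup_le fun c => iSup_le fun r => iSup_le fun hr => iSup_le fun hx => ?_
  have hle : ∀ h : X × ℝ → ℂ, μ (ball c r) ^ (-α) *
      eLpNorm h q ((μ (ball c r))⁻¹ • (halfMeasure μ).restrict (tent (ball c r))) ≤
        carleson μ q α h x := fun h =>
    le_iSup_of_le c (le_iSup_of_le r (le_iSup_of_le hr (le_iSup_of_le hx le_rfl)))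
  have hadd := eLpNorm_add_le'
    ((aestronglyMeasurable_volPow (-s) f).mono_ac
      (smul_restrict_ac (halfMeasure μ) (μ (ball c r))⁻¹ (tent (ball c r))))
    ((aestronglyMeasurable_volPow (-s) g).mono_ac
      (smul_restrict_ac (halfMeasure μ) (μ (ball c r))⁻¹ (tent (ball c r)))) q
  refine (mul_le_mul_right hadd _).trans ?_
  rw [mul_left_comm, mul_add]
  gcongr
  · exact hle _
  · exact hle _

theorem carlesonNorm_smul_le {μ : Measure X} (q : ℝ≥0∞) (s α : ℝ) (c : ℂ) (f : L0 μ) :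
    carlesonNorm μ q s α (c • f) ≤ ‖c‖ₑ * carlesonNorm μ q s α f := by
  rw [carlesonNorm, carleson_congr (volPow_smul (-s) c f)]
  refine eLpNorm_le_nnreal_smul_eLpNorm_of_ae_le_mul' (.of_forall fun x => ?_) ∞
  simp only [enorm_eq_self]
  refine iSup_le fun b => iSup_le fun r => iSup_le fun hr => iSup_le fun hx => ?_
  refine (mul_le_mul_right eLpNorm_const_smul_le _).trans ?_
  rw [mul_left_comm]
  refine mul_le_mul_right ?_ _
  exact le_iSup_of_le b (le_iSup_of_le r (le_iSup_of_le hr (le_iSup_of_le hx le_rfl)))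

theorem carlesonNorm_zero (μ : Measure X) (q : ℝ≥0∞) (s α : ℝ) : carlesonNorm μ q s α 0 = 0 := by
  have h : carleson μ q α (volPow μ (-s) (0 : L0 μ)) = 0 := by
    rw [carleson_congr (volPow_zero (-s))]
    funext x
    simp [carleson]
  rw [carlesonNorm, h, eLpNorm_zero]

/-! ### The spaces, the dual and the pairing -/

section Spaces

variable [BorelSpace X] (μ : Measure X) [Nondegenerate μ]

/-- The weighted tent space `T^{p,q}_s`. -/
def tentSpace (p q : ℝ≥0∞) (s : ℝ) : Submodule ℂ (L0 μ) where
  carrier := {f | tentNorm μ p q s f < ∞}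
  add_mem' {f g} hf hg := (tentNorm_add_le p q s f g).trans_lt
    (ENNReal.mul_lt_top (ENNReal.LpAddConst_lt_top q)
      (ENNReal.mul_lt_top (ENNReal.LpAddConst_lt_top p) (ENNReal.add_lt_top.2 ⟨hf, hg⟩)))
  zero_mem' := by simp [tentNorm_zero]
  smul_mem' c f hf := (tentNorm_smul_le p q s c f).trans_lt (ENNReal.mul_lt_top enorm_lt_top hf)

/-- The weighted Carleson-type space `T^{∞,q}_{s;α}`. -/
def carlesonSpace (q : ℝ≥0∞) (s α : ℝ) : Submodule ℂ (L0 μ) where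
  carrier := {f | carlesonNorm μ q s α f < ∞}
  add_mem' {f g} hf hg := (carlesonNorm_add_le q s α f g).trans_lt
    (ENNReal.mul_lt_top (ENNReal.LpAddConst_lt_top q) (ENNReal.add_lt_top.2 ⟨hf, hg⟩))
  zero_mem' := by simp [carlesonNorm_zero]
  smul_mem' c f hf := (carlesonNorm_smul_le q s α c f).trans_lt
    (ENNReal.mul_lt_top enorm_lt_top hf)

/-- The dual of the quasi-normed space `T^{p,q}_s`: the bounded linear functionals on it. -/
def tentDual (p q : ℝ≥0∞) (s : ℝ) : Submodule ℂ (Module.Dual ℂ (tentSpace μ p q s)) where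
  carrier := {φ | ∃ C : ℝ≥0, ∀ f : tentSpace μ p q s, ‖φ f‖ₑ ≤ C * tentNorm μ p q s f}
  add_mem' := by
    rintro φ ψ ⟨C, hC⟩ ⟨D, hD⟩
    refine ⟨C + D, fun f => ?_⟩
    rw [ENNReal.coe_add, add_mul]
    exact (enorm_add_le _ _).trans (add_le_add (hC f) (hD f))
  zero_mem' := ⟨0, fun f => by simp⟩
  smul_mem' := by
    rintro c φ ⟨C, hC⟩
    refine ⟨‖c‖₊ * C, fun f => ?_⟩
    rw [LinearMap.smul_apply, enorm_smul, ENNReal.coe_mul, mul_assoc]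
    exact mul_le_mul_right (hC f) _

variable {μ} in
/-- The dual norm `‖φ‖ = sup {|φ(f)| : ‖f‖_{T^{p,q}_s} ≤ 1}`. -/
def dualNorm {p q : ℝ≥0∞} {s : ℝ} (φ : tentDual μ p q s) : ℝ≥0∞ :=
  ⨆ (f : tentSpace μ p q s) (_ : tentNorm μ p q s f ≤ 1),
    ‖(φ : Module.Dual ℂ (tentSpace μ p q s)) f‖ₑ

end Spaces

/-- The `L²(X⁺)` inner product `⟨f,g⟩ = ∬ f(x,t) conj(g(x,t)) dμ(x) dt/t`. -/
def pairing (μ : Measure X) (f g : L0 μ) : ℂ := ∫ z, f z * conj (g z) ∂(halfMeasure μ)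

/-- `δ_{p,q} = 1/q - 1/p`, with `1/∞ = 0`. -/
def delta (p q : ℝ≥0∞) : ℝ := (1 / q).toReal - (1 / p).toReal

end TentSpace

end

open TentSpace

/-!
Call `g` Köthe dual to `T^{p,q}_s` if `∬ |f g| ≤ M ‖f‖` for some finite `M` and all `f`. For `p ≤ 1`
this is the same as membership in `T^{∞,q'}_{-s;1/p-1}`, with equivalent norms; the weights `V^{∓s}`
cancel in `f g`, so let `s = 0`.

If `‖g‖_{L^{q'}(T(B))} ≤ N μ(B)^{1/p-1/q}` for all balls `B`, let `A` be the Lusin function of `f`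
and split `X^+` according to the `k ∈ ℤ` for which the median of `A` over `B(y,t)` lies in
`(2^k, 2^{k+1}]`. On such a piece `E_k` half of each `B(y,t)` has `A ≤ 2^{k+1}`, so averaging over
cones controls `f` in `L^q(E_k ∩ T(B))` by `2^{k+2} μ(B)^{1/q}`, and Hölder gives
`∬_{E_k ∩ T(B)} |f g| ≤ 2^{k+2} N μ(B)^{1/p}`. Also `B(y,t)` meets `{A > 2^k}` in at least half of
its measure, so a Vitali covering of `E_k` by tents and the superadditivity of `u ↦ u^{1/p}` give
`∬_{E_k} |f g| ≲ N 2^k μ{A > 2^k}^{1/p}`. Since `ℓ^p ⊂ ℓ^1`, summing over `k` yields `N ‖A‖_p`.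
Conversely, for `f` supported in `T(B)` the function `A` lives on `B`, hence
`‖A‖_p ≤ μ(B)^{1/p-1/q} ‖f‖_{L^q}`, and testing on such `f` bounds `g` in `L^{q'}(T(B))`.

For surjectivity, dominated convergence makes every bounded functional `φ` order continuous, so for
fixed `f` the set function `S ↦ φ(1_S f)` is a complex measure, with a density by Radon–Nikodym.
Dividing the density of a nowhere vanishing `w ∈ T^{p,q}_s` by `w` gives one `g` that represents
`φ`.
-/

namespace TentSpace

section Series

theorem tsum_rpow_le_rpow_tsum {ι : Type*} (a : ι → ℝ≥0∞) {r : ℝ} (hr : 1 ≤ r) :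
    ∑' i, a i ^ r ≤ (∑' i, a i) ^ r := by
  have rpow_eq (b : ℝ≥0∞) : b ^ r = b * b ^ (r - 1) := by
    nth_rw 2 [← ENNReal.rpow_one b]
    rw [← ENNReal.rpow_add_of_nonneg _ _ zero_le_one (by linarith), add_sub_cancel]
  rw [rpow_eq (∑' i, a i), ← ENNReal.tsum_mul_right]
  refine ENNReal.tsum_le_tsum fun i => ?_
  rw [rpow_eq]
  gcongr
  exact ENNReal.le_tsum i

theorem tsum_ite_zpow_rpow_le {p : ℝ} (hp : 0 < p) (a : ℝ≥0∞) :
    ∑' k : ℤ, (if (2 : ℝ≥0∞) ^ k < a then ((2 : ℝ≥0∞) ^ k) ^ p else 0) ≤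
      (1 - 2 ^ (-p))⁻¹ * a ^ p := by
  have hc : ((1 : ℝ≥0∞) - 2 ^ (-p))⁻¹ ≠ 0 :=
    ENNReal.inv_ne_zero.2 (ENNReal.sub_ne_top ENNReal.one_ne_top)
  rcases eq_or_ne a 0 with rfl | ha0
  · simp
  rcases eq_or_ne a ∞ with rfl | ha
  · simp [ENNReal.top_rpow_of_pos hp, ENNReal.mul_top hc]
  obtain ⟨j, hj, hj'⟩ := ENNReal.exists_mem_Ioc_zpow ha0 ha ENNReal.one_lt_two ENNReal.ofNat_ne_top
  have hinj : Function.Injective fun n : ℕ => j - (n : ℤ) := fun m n h => by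
    simp only at h; lia
  have hterm (n : ℕ) : (if (2 : ℝ≥0∞) ^ (j - (n : ℤ)) < a then ((2 : ℝ≥0∞) ^ (j - (n : ℤ))) ^ p
      else 0) ≤ ((2 : ℝ≥0∞) ^ (-p)) ^ n * a ^ p := by
    split_ifs
    · calc ((2 : ℝ≥0∞) ^ (j - (n : ℤ))) ^ p = ((2 : ℝ≥0∞) ^ (-p)) ^ n * ((2 : ℝ≥0∞) ^ j) ^ p := by
            simp only [← ENNReal.rpow_intCast, ← ENNReal.rpow_natCast, ← ENNReal.rpow_mul]
            rw [← ENNReal.rpow_add _ _ two_ne_zero ENNReal.ofNat_ne_top]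
            push_cast
            ring_nf
        _ ≤ ((2 : ℝ≥0∞) ^ (-p)) ^ n * a ^ p := by gcongr
    · exact zero_le
  rw [← hinj.tsum_eq]
  · calc _ ≤ ∑' n : ℕ, ((2 : ℝ≥0∞) ^ (-p)) ^ n * a ^ p := ENNReal.tsum_le_tsum hterm
      _ = (1 - 2 ^ (-p))⁻¹ * a ^ p := by rw [ENNReal.tsum_mul_right, ENNReal.tsum_geometric]
  · intro k hk
    simp only [Function.mem_support, ne_eq, ite_eq_right_iff, not_forall] at hk
    have hkj : k < j + 1 := by
      by_contra! h
      exact (hk.1.trans_le hj').not_ge (ENNReal.zpow_le_of_le one_le_two h)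
    exact ⟨(j - k).toNat, by simp only; lia⟩

end Series

section Measure

open Filter Topology

variable {Ω E : Type*} [MeasurableSpace Ω] {m : Measure Ω} [NormedAddCommGroup E]

theorem tsum_zpow_rpow_mul_measure_lt_le {p : ℝ} (hp : 0 < p) {A : Ω → ℝ≥0∞} (hA : Measurable A) :
    ∑' k : ℤ, ((2 : ℝ≥0∞) ^ k) ^ p * m {x | (2 : ℝ≥0∞) ^ k < A x} ≤
      (1 - 2 ^ (-p))⁻¹ * ∫⁻ x, A x ^ p ∂m := by
  have hm (k : ℤ) : MeasurableSet {x | (2 : ℝ≥0∞) ^ k < A x} := measurableSet_lt measurable_const hA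
  calc ∑' k : ℤ, ((2 : ℝ≥0∞) ^ k) ^ p * m {x | (2 : ℝ≥0∞) ^ k < A x}
      = ∑' k : ℤ, ∫⁻ x, (if (2 : ℝ≥0∞) ^ k < A x then ((2 : ℝ≥0∞) ^ k) ^ p else 0) ∂m := by
        refine tsum_congr fun k => ?_
        rw [← lintegral_indicator_const (hm k)]
        simp only [indicator_apply, mem_ofPred_eq]
    _ = ∫⁻ x, ∑' k : ℤ, (if (2 : ℝ≥0∞) ^ k < A x then ((2 : ℝ≥0∞) ^ k) ^ p else 0) ∂m :=
        (lintegral_tsum fun k => (Measurable.ite (hm k) measurable_const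
          measurable_const).aemeasurable).symm
    _ ≤ ∫⁻ x, (1 - 2 ^ (-p))⁻¹ * A x ^ p ∂m :=
        lintegral_mono fun x => tsum_ite_zpow_rpow_le hp (A x)
    _ = (1 - 2 ^ (-p))⁻¹ * ∫⁻ x, A x ^ p ∂m := lintegral_const_mul _ (hA.pow_const p)

theorem ae_lt_top_of_eLpNorm_lt_top {p : ℝ≥0∞} (hp0 : p ≠ 0) {f : Ω → ℝ≥0∞} (hf : Measurable f)
    (h : eLpNorm f p m < ∞) : ∀ᵐ x ∂m, f x < ∞ := by
  rcases eq_or_ne p ∞ with rfl | hp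
  · exact (enorm_ae_le_eLpNormEssSup f m).mono fun x hx => hx.trans_lt h
  have hint := lintegral_rpow_enorm_lt_top_of_eLpNorm_lt_top hp0 hp h
  filter_upwards [ae_lt_top (hf.enorm.pow_const _) hint.ne] with x hx
  exact (ENNReal.rpow_lt_top_iff_of_pos (ENNReal.toReal_pos hp0 hp)).1 hx

theorem tendsto_eLpNorm_zero_of_dominated {ε ε' : Type*} [ENorm ε] [ENorm ε'] {p : ℝ≥0∞}
    (hp : p ≠ ∞) {f : ℕ → Ω → ε} {b : Ω → ε'} (hf : ∀ n, AEMeasurable (fun x => ‖f n x‖ₑ) m)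
    (hb : eLpNorm b p m < ∞) (hfb : ∀ n, ∀ᵐ x ∂m, ‖f n x‖ₑ ≤ ‖b x‖ₑ)
    (hlim : ∀ᵐ x ∂m, Tendsto (fun n => ‖f n x‖ₑ) atTop (𝓝 0)) :
    Tendsto (fun n => eLpNorm (f n) p m) atTop (𝓝 0) := by
  rcases eq_or_ne p 0 with rfl | hp0
  · simp
  have hr : 0 < p.toReal := ENNReal.toReal_pos hp0 hp
  have hint : Tendsto (fun n => ∫⁻ x, ‖f n x‖ₑ ^ p.toReal ∂m) atTop (𝓝 (∫⁻ _, 0 ∂m)) := by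
    refine tendsto_lintegral_of_dominated_convergence' (fun x => ‖b x‖ₑ ^ p.toReal)
      (fun n => (hf n).pow_const _) (fun n => ?_)
      (lintegral_rpow_enorm_lt_top_of_eLpNorm_lt_top hp0 hp hb).ne ?_
    · filter_upwards [hfb n] with x hx
      gcongr
    · filter_upwards [hlim] with x hx
      simpa [hr] using hx.ennrpow_const p.toReal
  simp only [eLpNorm_eq_lintegral_rpow_enorm_toReal hp0 hp]
  simpa [hr] using hint.ennrpow_const (1 / p.toReal)

theorem lintegral_enorm_mul_enorm_le {F : Type*} [NormedAddCommGroup F] {q q' : ℝ≥0∞}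
    [ENNReal.HolderConjugate q q'] {f : Ω → E} {g : Ω → F}
    (hf : AEStronglyMeasurable f m) (hg : AEStronglyMeasurable g m) :
    ∫⁻ z, ‖f z‖ₑ * ‖g z‖ₑ ∂m ≤ eLpNorm f q m * eLpNorm g q' m := by
  have h := eLpNorm_smul_le_mul_eLpNorm (p := q) (q := q') (r := 1) hg.norm hf.norm
  rw [eLpNorm_norm, eLpNorm_norm, eLpNorm_one_eq_lintegral_enorm] at h
  simpa [enorm_mul] using h

theorem enorm_nnreal (x : ℝ≥0) : ‖x‖ₑ = x := rfl

theorem setLIntegral_enorm_rpow_le_of_forall_lintegral_mul_le {q q' : ℝ≥0∞}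
    [ENNReal.HolderConjugate q q'] (hq : q ≠ ∞) (hq' : q' ≠ ∞) {g : Ω → E}
    (hg : StronglyMeasurable g) {M : ℝ≥0∞} (h : ∀ f : Ω → ℝ≥0, Measurable f → eLpNorm f q m < ∞ →
      ∫⁻ z, f z * ‖g z‖ₑ ∂m ≤ M * eLpNorm f q m) {S : Set Ω} (hS : MeasurableSet S)
    (hgS : ∫⁻ z in S, ‖g z‖ₑ ^ q'.toReal ∂m ≠ ∞) :
    ∫⁻ z in S, ‖g z‖ₑ ^ q'.toReal ∂m ≤ M ^ q'.toReal := by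
  have hr : q.toReal.HolderConjugate q'.toReal := ENNReal.HolderConjugate.toReal_of_ne_top hq hq'
  set I := ∫⁻ z in S, ‖g z‖ₑ ^ q'.toReal ∂m with hI
  -- Test against `|g|^(q'-1)` on `S`, the equality case of Hölder's inequality.
  set f : Ω → ℝ≥0 := S.indicator fun z => ‖g z‖₊ ^ (q'.toReal - 1)
  have hf : Measurable f := (hg.nnnorm.measurable.pow_const _).indicator hS
  have hfg : ∫⁻ z, f z * ‖g z‖ₑ ∂m = I := by
    rw [hI, ← lintegral_indicator hS]
    refine lintegral_congr fun z => ?_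
    by_cases hz : z ∈ S
    · simp only [f, indicator_of_mem hz]
      rw [ENNReal.coe_rpow_of_nonneg _ (by linarith [hr.symm.lt]), ← enorm_eq_nnnorm]
      nth_rw 2 [← ENNReal.rpow_one ‖g z‖ₑ]
      rw [← ENNReal.rpow_add_of_nonneg _ _ (by linarith [hr.symm.lt]) zero_le_one, sub_add_cancel]
    · simp [f, indicator_of_notMem hz]
  have hfnorm : eLpNorm f q m = I ^ q.toReal⁻¹ := by
    rw [eLpNorm_eq_lintegral_rpow_enorm_toReal (ENNReal.HolderConjugate.ne_zero q q') hq, one_div,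
      hI, ← lintegral_indicator hS]
    congr 1
    refine lintegral_congr fun z => ?_
    by_cases hz : z ∈ S
    · simp only [f, indicator_of_mem hz, enorm_nnreal]
      rw [ENNReal.coe_rpow_of_nonneg _ (by linarith [hr.symm.lt]), ← enorm_eq_nnnorm,
        ← ENNReal.rpow_mul, hr.symm.sub_one_mul_conj]
    · simp [f, indicator_of_notMem hz, hr.pos, enorm_nnreal]
  have htest : I ≤ M * I ^ q.toReal⁻¹ := by
    simpa only [hfg, hfnorm] using h f hf (by rw [hfnorm]; finiteness)
  rcases eq_or_ne I 0 with hI0 | hI0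
  · simp [hI0]
  have hsplit : I = I ^ q'.toReal⁻¹ * I ^ q.toReal⁻¹ := by
    rw [← ENNReal.rpow_add_of_nonneg _ _ hr.symm.inv_nonneg hr.inv_nonneg,
      hr.symm.inv_add_inv_eq_one, ENNReal.rpow_one]
  rw [← ENNReal.rpow_inv_le_iff hr.symm.pos, ← ENNReal.mul_le_mul_iff_left
    (c := I ^ q.toReal⁻¹) (by simp [hI0, hgS]) (by finiteness), ← hsplit]
  exact htest

theorem eLpNorm_le_of_forall_lintegral_mul_le [SigmaFinite m] {q q' : ℝ≥0∞}
    [hqq' : ENNReal.HolderConjugate q q'] (hq : q ≠ ∞) {g : Ω → E} (hg : StronglyMeasurable g)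
    {M : ℝ≥0∞} (h : ∀ f : Ω → ℝ≥0, Measurable f → eLpNorm f q m < ∞ →
      ∫⁻ z, f z * ‖g z‖ₑ ∂m ≤ M * eLpNorm f q m) :
    eLpNorm g q' m ≤ M := by
  rcases eq_or_ne q' ∞ with rfl | hq'
  · obtain rfl : q = 1 := by simpa using ENNReal.holderConjugate_iff.1 hqq'
    rw [eLpNorm_exponent_top]
    refine essSup_le_of_ae_le M <| ae_le_of_forall_setLIntegral_le_of_sigmaFinite hg.enorm
      fun S hS hmS => ?_
    have hnorm : eLpNorm (S.indicator fun _ => (1 : ℝ≥0)) 1 m = m S := by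
      rw [eLpNorm_one_eq_lintegral_enorm, ← lintegral_indicator_one hS]
      refine lintegral_congr fun z => ?_
      by_cases hz : z ∈ S <;> simp [hz, enorm_nnreal]
    have htest := h (S.indicator fun _ => 1) (measurable_const.indicator hS) (hnorm ▸ hmS)
    rw [hnorm] at htest
    rw [setLIntegral_const, ← lintegral_indicator hS]
    refine (lintegral_congr fun z => ?_).trans_le htest
    by_cases hz : z ∈ S <;> simp [hz]
  · have hr : 0 < q'.toReal :=
      ENNReal.toReal_pos (ENNReal.HolderConjugate.ne_zero q' q) hq'
    set S : ℕ → Set Ω := fun n => spanningSets m n ∩ {z | ‖g z‖ₑ ≤ n}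
    have hSmono : Monotone S := fun k n hkn => inter_subset_inter (monotone_spanningSets m hkn)
      fun z (hz : ‖g z‖ₑ ≤ k) => show ‖g z‖ₑ ≤ n from hz.trans (Nat.cast_le.2 hkn)
    have hSuniv : ⋃ n, S n = univ := by
      refine eq_univ_of_forall fun z => mem_iUnion.2 ?_
      obtain ⟨n, hn⟩ := ENNReal.exists_nat_gt (r := ‖g z‖ₑ) (by simp)
      obtain ⟨k, hk⟩ := mem_iUnion.1 (iUnion_spanningSets m ▸ mem_univ z)
      exact ⟨max k n, monotone_spanningSets m (le_max_left _ _) hk,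
        hn.le.trans (Nat.cast_le.2 (le_max_right k n))⟩
    have hbound (n : ℕ) : ∫⁻ z in S n, ‖g z‖ₑ ^ q'.toReal ∂m ≤ M ^ q'.toReal := by
      refine setLIntegral_enorm_rpow_le_of_forall_lintegral_mul_le hq hq' hg h
        ((measurableSet_spanningSets m n).inter (measurableSet_le hg.enorm measurable_const))
        (setLIntegral_lt_top_of_le_nnreal (measure_mono inter_subset_left |>.trans_lt
          (measure_spanningSets_lt_top m n)).ne ⟨(n : ℝ≥0) ^ q'.toReal, fun z hz => ?_⟩).ne
      rw [ENNReal.coe_rpow_of_nonneg _ hr.le]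
      exact ENNReal.rpow_le_rpow hz.2 hr.le
    rw [eLpNorm_eq_lintegral_rpow_enorm_toReal (ENNReal.HolderConjugate.ne_zero q' q) hq', one_div,
      ENNReal.rpow_inv_le_iff hr, ← setLIntegral_univ, ← hSuniv,
      setLIntegral_iUnion_of_directed _ hSmono.directed_le]
    exact iSup_le hbound

end Measure

section UpperMedian

open Filter Topology

variable {Ω : Type*} [MeasurableSpace Ω] {ν : Measure Ω} {A : Ω → ℝ≥0∞} {a : ℝ≥0∞}

/-- The upper median of `A` with respect to `ν`: the least `a` such that `A` exceeds `a` on at most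
half of the mass of `ν`. -/
noncomputable def upperMedian (ν : Measure Ω) (A : Ω → ℝ≥0∞) : ℝ≥0∞ :=
  sInf {a | 2 * ν {x | a < A x} ≤ ν univ}

theorem upperMedian_le_iff : upperMedian ν A ≤ a ↔ 2 * ν {x | a < A x} ≤ ν univ := by
  refine ⟨fun ha => ?_, fun ha => sInf_le ha⟩
  obtain ⟨u, hu, hlim, hmem⟩ := exists_seq_tendsto_sInf
    (S := {a | 2 * ν {x | a < A x} ≤ ν univ}) ⟨∞, by simp⟩ (OrderBot.bddBelow _)
  have hmono : Monotone fun n => {x | u n < A x} :=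
    fun k n hkn x (hx : u k < A x) => show u n < A x from (hu hkn).trans_lt hx
  have hsub : {x | a < A x} ⊆ ⋃ n, {x | u n < A x} := fun x (hx : a < A x) =>
    mem_iUnion.2 (hlim.eventually_lt_const (ha.trans_lt hx)).exists
  calc 2 * ν {x | a < A x} ≤ 2 * ⨆ n, ν {x | u n < A x} := by
        rw [← hmono.measure_iUnion]
        gcongr
    _ ≤ ν univ := by
        rw [ENNReal.mul_iSup]
        exact iSup_le hmem

theorem measure_univ_le_two_mul_of_upperMedian_le [IsFiniteMeasure ν] (hA : Measurable A)
    (ha : upperMedian ν A ≤ a) : ν univ ≤ 2 * ν {x | A x ≤ a} := by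
  have hcompl : {x | A x ≤ a}ᶜ = {x | a < A x} := by
    ext x
    simp
  have hsplit :=
    measure_add_measure_compl (μ := ν) (measurableSet_le hA (measurable_const (a := a)))
  rw [hcompl] at hsplit
  refine (ENNReal.add_le_add_iff_right (measure_ne_top ν univ)).1 ?_
  calc ν univ + ν univ = 2 * ν {x | A x ≤ a} + 2 * ν {x | a < A x} := by
        rw [← mul_add, hsplit, two_mul]
    _ ≤ 2 * ν {x | A x ≤ a} + ν univ := by
        gcongr
        exact upperMedian_le_iff.1 ha

theorem upperMedian_lt_top [IsFiniteMeasure ν] [NeZero ν] (hA : Measurable A)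
    (hAfin : ∀ᵐ x ∂ν, A x < ∞) : upperMedian ν A < ∞ := by
  have hlim : Tendsto (fun n : ℕ => ν {x | (n : ℝ≥0∞) < A x}) atTop (𝓝 0) := by
    have hinter : ν (⋂ n : ℕ, {x | (n : ℝ≥0∞) < A x}) = 0 := by
      refine measure_mono_null (fun x hx => ?_) (ae_iff.1 hAfin)
      rintro hlt
      obtain ⟨n, hn⟩ := ENNReal.exists_nat_gt (ne_of_lt hlt)
      exact (mem_iInter.1 hx n).not_gt hn
    rw [← hinter]
    exact tendsto_measure_iInter_atTop
      (fun n => (measurableSet_lt measurable_const hA).nullMeasurableSet)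
      (fun k n hkn x (hx : (n : ℝ≥0∞) < A x) =>
        show (k : ℝ≥0∞) < A x from (Nat.cast_le.2 hkn).trans_lt hx) ⟨0, measure_ne_top _ _⟩
  obtain ⟨n, hn⟩ := (hlim.eventually_lt_const
    (ENNReal.half_pos (Measure.measure_univ_ne_zero.2 (NeZero.ne ν)))).exists
  refine (upperMedian_le_iff.2 ?_).trans_lt (ENNReal.natCast_lt_top n)
  rw [mul_comm, ← ENNReal.le_div_iff_mul_le (by simp) (by simp)]
  exact hn.le

end UpperMedian

section Representation

open Filter Topology

variable {Ω : Type*} [MeasurableSpace Ω] {m : Measure Ω}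

/-- Normality of a linear functional on `L^∞(m)`: it is continuous along bounded sequences that
converge almost everywhere. Convergence to `0` is enough, by linearity. -/
def IsNormal (ψ : Lp ℂ ∞ m →ₗ[ℂ] ℂ) : Prop :=
  ∀ ⦃h : ℕ → Lp ℂ ∞ m⦄ ⦃C : ℝ⦄, (∀ n, ∀ᵐ z ∂m, ‖h n z‖ ≤ C) →
    (∀ᵐ z ∂m, Tendsto (fun n => h n z) atTop (𝓝 0)) → Tendsto (fun n => ψ (h n)) atTop (𝓝 0)

theorem IsNormal.sub {ψ χ : Lp ℂ ∞ m →ₗ[ℂ] ℂ} (hψ : IsNormal ψ) (hχ : IsNormal χ) :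
    IsNormal (ψ - χ) := fun h C hbdd hlim => by
  simpa using (hψ hbdd hlim).sub (hχ hbdd hlim)

/-- Integration against an integrable function, as a functional on `L^∞(m)`. -/
noncomputable def integralMul {g : Ω → ℂ} (hg : Integrable g m) : Lp ℂ ∞ m →ₗ[ℂ] ℂ where
  toFun h := ∫ z, h z * g z ∂m
  map_add' h k := by
    refine (integral_congr_ae ?_).trans
      (integral_add (hg.mul_of_top_right (Lp.memLp h)) (hg.mul_of_top_right (Lp.memLp k)))
    filter_upwards [Lp.coeFn_add h k] with z hz
    rw [hz, Pi.add_apply, add_mul]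
  map_smul' c h := by
    rw [RingHom.id_apply, smul_eq_mul, ← integral_const_mul]
    refine integral_congr_ae ?_
    filter_upwards [Lp.coeFn_smul c h] with z hz
    simp [hz, mul_assoc]

theorem isNormal_integralMul {g : Ω → ℂ} (hg : Integrable g m) : IsNormal (integralMul hg) := by
  intro h C hbdd hlim
  have := tendsto_integral_of_dominated_convergence (fun z => C * ‖g z‖) (f := fun _ => 0)
    (F := fun n z => h n z * g z)
    (fun n => (Lp.aestronglyMeasurable (h n)).mul hg.aestronglyMeasurable) (hg.norm.const_mul C)
    (fun n => ?_) ?_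
  · simpa [integralMul] using this
  · filter_upwards [hbdd n] with z hz
    rw [norm_mul]
    gcongr
  · filter_upwards [hlim] with z hz
    simpa using hz.mul_const (g z)

variable (m) in
/-- The class of the indicator function of `s` in `L^∞(m)`; unlike for `indicatorConstLp`, the set
`s` may have infinite measure. -/
noncomputable def indicatorTop {s : Set Ω} (hs : MeasurableSet s) : Lp ℂ ∞ m :=
  ((memLp_top_const (1 : ℂ)).indicator hs).toLp (s.indicator fun _ => (1 : ℂ))

theorem coeFn_indicatorTop {s : Set Ω} (hs : MeasurableSet s) :
    indicatorTop m hs =ᵐ[m] s.indicator fun _ => (1 : ℂ) := MemLp.coeFn_toLp _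

theorem IsNormal.hasSum_indicatorTop {ψ : Lp ℂ ∞ m →ₗ[ℂ] ℂ} (hψ : IsNormal ψ) {A : ℕ → Set Ω}
    (hA : ∀ i, MeasurableSet (A i)) (hdisj : Pairwise (Function.onFun Disjoint A)) :
    HasSum (fun i => ψ (indicatorTop m (hA i))) (ψ (indicatorTop m (.iUnion hA))) := by
  refine tendsto_of_seq_tendsto fun S hS => ?_
  have hdiff (n : ℕ) : (∑ i ∈ S n, indicatorTop m (hA i) - indicatorTop m (.iUnion hA) : Lp ℂ ∞ m)
      =ᵐ[m] (⋃ i ∈ S n, A i).indicator (fun _ => (1 : ℂ)) - (⋃ i, A i).indicator fun _ => 1 := by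
    have hall : ∀ᵐ z ∂m, ∀ i, indicatorTop m (hA i) z = (A i).indicator (fun _ => (1 : ℂ)) z :=
      ae_all_iff.2 fun i => coeFn_indicatorTop (hA i)
    filter_upwards [Lp.coeFn_sub (∑ i ∈ S n, indicatorTop m (hA i)) (indicatorTop m (.iUnion hA)),
      Lp.coeFn_finsetSum (S n) fun i => indicatorTop m (hA i), hall,
      coeFn_indicatorTop (m := m) (.iUnion hA)] with z hsub hsum hind hU
    rw [hsub, Pi.sub_apply, Pi.sub_apply, hsum, hU, Finset.sum_apply,
      Finset.indicator_biUnion_apply _ _ (hdisj.set_pairwise _)]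
    simp only [hind]
  have hlim := hψ (h := fun n => ∑ i ∈ S n, indicatorTop m (hA i) - indicatorTop m (.iUnion hA))
    (C := 2) (fun n => ?_) ?_
  · simpa [tendsto_sub_nhds_zero_iff, Function.comp_def] using hlim
  · filter_upwards [hdiff n] with z hz
    rw [hz, Pi.sub_apply]
    exact (norm_sub_le _ _).trans ((add_le_add (norm_indicator_le_norm_self _ z)
      (norm_indicator_le_norm_self _ z)).trans (by norm_num))
  · filter_upwards [ae_all_iff.2 hdiff] with z hz
    refine tendsto_const_nhds.congr' ?_
    by_cases hzU : z ∈ ⋃ i, A i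
    · obtain ⟨i, hi⟩ := mem_iUnion.1 hzU
      filter_upwards [hS.eventually (eventually_ge_atTop {i})] with n hn
      have hzS : z ∈ ⋃ i ∈ S n, A i := mem_iUnion₂.2 ⟨i, Finset.singleton_subset_iff.1 hn, hi⟩
      rw [hz n, Pi.sub_apply, indicator_of_mem hzU, indicator_of_mem hzS, sub_self]
    · filter_upwards with n
      have hzS : z ∉ ⋃ i ∈ S n, A i := fun h => hzU (iUnion₂_subset_iUnion _ _ h)
      rw [hz n, Pi.sub_apply, indicator_of_notMem hzU, indicator_of_notMem hzS, sub_self]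

theorem indicatorTop_eq_zero {s : Set Ω} (hs : MeasurableSet s) (hms : m s = 0) :
    indicatorTop m hs = 0 := by
  refine Lp.eq_zero_iff_ae_eq_zero.2 ((coeFn_indicatorTop hs).trans ?_)
  exact indicator_meas_zero hms

open Classical in
/-- The complex measure `s ↦ ψ(1_s)` of a normal functional `ψ`. -/
noncomputable def IsNormal.toComplexMeasure {ψ : Lp ℂ ∞ m →ₗ[ℂ] ℂ} (hψ : IsNormal ψ) :
    ComplexMeasure Ω where
  measureOf' s := if hs : MeasurableSet s then ψ (indicatorTop m hs) else 0
  empty' := by rw [dif_pos .empty, indicatorTop_eq_zero .empty measure_empty, map_zero]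
  not_measurable' _ hs := dif_neg hs
  m_iUnion' A hA hdisj := by
    simp only [dif_pos (hA _), dif_pos (MeasurableSet.iUnion hA)]
    exact hψ.hasSum_indicatorTop hA hdisj

theorem IsNormal.toComplexMeasure_apply {ψ : Lp ℂ ∞ m →ₗ[ℂ] ℂ} (hψ : IsNormal ψ) {s : Set Ω}
    (hs : MeasurableSet s) : hψ.toComplexMeasure s = ψ (indicatorTop m hs) := dif_pos hs

theorem IsNormal.toComplexMeasure_absolutelyContinuous {ψ : Lp ℂ ∞ m →ₗ[ℂ] ℂ} (hψ : IsNormal ψ) :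
    VectorMeasure.AbsolutelyContinuous hψ.toComplexMeasure m.toENNRealVectorMeasure := by
  refine .mk fun s hs hms => ?_
  rw [Measure.toENNRealVectorMeasure_apply_measurable hs] at hms
  rw [hψ.toComplexMeasure_apply hs, indicatorTop_eq_zero hs hms, map_zero]

theorem withDensityᵥ_rnDeriv_eq_of_absolutelyContinuous [SigmaFinite m] {c : ComplexMeasure Ω}
    (hc : VectorMeasure.AbsolutelyContinuous c m.toENNRealVectorMeasure) :
    m.withDensityᵥ (c.rnDeriv m) = c := by
  have hsing {σ : SignedMeasure Ω}
      (hσ : VectorMeasure.AbsolutelyContinuous σ m.toENNRealVectorMeasure) :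
      σ.singularPart m = 0 := by
    have h := (SignedMeasure.absolutelyContinuous_iff_withDensityᵥ_rnDeriv_eq σ m).1 hσ
    simpa [h] using σ.singularPart_add_withDensity_rnDeriv_eq m
  obtain ⟨hre, him⟩ := (c.absolutelyContinuous_ennreal_iff _).1 hc
  have : c.HaveLebesgueDecomposition m := ⟨inferInstance, inferInstance⟩
  have hzero : c.singularPart m = 0 := by
    rw [ComplexMeasure.singularPart, hsing hre, hsing him]
    rfl
  simpa [hzero] using c.singularPart_add_withDensity_rnDeriv_eq (μ := m)

theorem ae_norm_le_norm_of_Lp_top (h : Lp ℂ ∞ m) : ∀ᵐ z ∂m, ‖h z‖ ≤ ‖h‖ := by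
  filter_upwards [enorm_ae_le_eLpNormEssSup h m] with z hz
  rwa [← eLpNorm_exponent_top, ← Lp.enorm_def, enorm_le_iff_norm_le] at hz

theorem IsNormal.eq_zero_of_forall_indicatorTop {ψ : Lp ℂ ∞ m →ₗ[ℂ] ℂ} (hψ : IsNormal ψ)
    (hind : ∀ (s : Set Ω) (hs : MeasurableSet s), ψ (indicatorTop m hs) = 0) : ψ = 0 := by
  have hsimple (f : SimpleFunc Ω ℂ) : ψ ((f.memLp_top m).toLp f) = 0 := by
    induction f using SimpleFunc.induction with
    | @const c s hs =>
      have hcs : (((SimpleFunc.const Ω c).piecewise s hs (SimpleFunc.const Ω 0)).memLp_top m).toLp _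
          = c • indicatorTop m hs := by
        refine Lp.ext ?_
        filter_upwards [MemLp.coeFn_toLp (((SimpleFunc.const Ω c).piecewise s hs
          (SimpleFunc.const Ω 0)).memLp_top m), Lp.coeFn_smul c (indicatorTop m hs),
          coeFn_indicatorTop (m := m) hs] with z h₁ h₂ h₃
        rw [h₁, h₂, Pi.smul_apply, h₃]
        by_cases hz : z ∈ s <;> simp [hz]
      rw [hcs, map_smul, hind, smul_zero]
    | @add f f' _ hf hf' =>
      have hadd : ((f + f').memLp_top m).toLp _ =
          (f.memLp_top m).toLp _ + (f'.memLp_top m).toLp _ :=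
        MemLp.toLp_add (f.memLp_top m) (f'.memLp_top m)
      rw [hadd, map_add, hf, hf', add_zero]
  ext h
  have hsm : StronglyMeasurable h := Lp.stronglyMeasurable h
  have hbdd : ∀ᵐ z ∂m, ‖h z‖ ≤ ‖h‖ := ae_norm_le_norm_of_Lp_top h
  have hlim := hψ (C := ‖h‖ + ‖h‖)
    (h := fun n => h - ((hsm.approxBounded ‖h‖ n).memLp_top m).toLp _) ?_ ?_
  · simpa [hsimple] using hlim
  · intro n
    filter_upwards [Lp.coeFn_sub h (((hsm.approxBounded ‖h‖ n).memLp_top m).toLp _),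
      MemLp.coeFn_toLp ((hsm.approxBounded ‖h‖ n).memLp_top m), hbdd] with z hsub happrox hz
    rw [hsub, Pi.sub_apply, happrox]
    exact (norm_sub_le _ _).trans
      (add_le_add hz (hsm.norm_approxBounded_le (norm_nonneg h) n z))
  · filter_upwards [ae_all_iff.2 fun n =>
      Lp.coeFn_sub h (((hsm.approxBounded ‖h‖ n).memLp_top m).toLp _), ae_all_iff.2 fun n =>
      MemLp.coeFn_toLp ((hsm.approxBounded ‖h‖ n).memLp_top m), hbdd] with z hsub happrox hz
    simp only [hsub, Pi.sub_apply, happrox]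
    simpa using (hsm.tendsto_approxBounded_of_norm_le hz).const_sub (h z)

theorem IsNormal.exists_eq_integralMul [SigmaFinite m] {ψ : Lp ℂ ∞ m →ₗ[ℂ] ℂ} (hψ : IsNormal ψ) :
    ∃ (g : Ω → ℂ) (hg : Integrable g m), ψ = integralMul hg := by
  have hg := hψ.toComplexMeasure.integrable_rnDeriv m
  refine ⟨_, hg, sub_eq_zero.1 ?_⟩
  refine (hψ.sub (isNormal_integralMul hg)).eq_zero_of_forall_indicatorTop fun s hs => ?_
  have hdensity : ψ (indicatorTop m hs) = ∫ z in s, hψ.toComplexMeasure.rnDeriv m z ∂m := by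
    rw [← withDensityᵥ_apply hg hs, withDensityᵥ_rnDeriv_eq_of_absolutelyContinuous
      hψ.toComplexMeasure_absolutelyContinuous, hψ.toComplexMeasure_apply hs]
  rw [LinearMap.sub_apply, hdensity, ← integral_indicator hs, sub_eq_zero]
  refine integral_congr_ae ?_
  filter_upwards [coeFn_indicatorTop (m := m) hs] with z hz
  by_cases hzs : z ∈ s <;> simp [hz, hzs]

end Representation

section HalfSpace

variable {X : Type*} [MetricSpace X]

theorem mem_of_mem_cone_of_mem_tent {B : Set X} {x : X} {z : X × ℝ} (hz : z ∈ cone x)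
    (hB : z ∈ tent B) : x ∈ B :=
  hB.2 (mem_ball_comm.1 hz)

variable [MeasurableSpace X]

theorem Doubling.exists_measure_ball_five_mul_le {μ : Measure X} (h : Doubling μ) :
    ∃ D : ℝ≥0, ∀ (x : X) (r : ℝ), 0 < r → μ (ball x (5 * r)) ≤ D * μ (ball x r) := by
  obtain ⟨C, -, hC⟩ := h
  refine ⟨C * (C * C), fun x r hr => ?_⟩
  calc μ (ball x (5 * r)) ≤ μ (ball x (2 * (2 * (2 * r)))) :=
        measure_mono (ball_subset_ball (by linarith))
    _ ≤ C * μ (ball x (2 * (2 * r))) := hC x _ (by positivity)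
    _ ≤ C * (C * μ (ball x (2 * r))) := by
        gcongr
        exact hC x _ (by positivity)
    _ ≤ C * (C * (C * μ (ball x r))) := by
        gcongr
        exact hC x r hr
    _ = (C * (C * C) : ℝ≥0) * μ (ball x r) := by
        push_cast
        ring

theorem lusin_rpow {μ : Measure X} {q : ℝ≥0∞} (hq0 : q ≠ 0) (hq : q ≠ ∞) (F : X × ℝ → ℂ) (x : X) :
    lusin μ q F x ^ q.toReal = ∫⁻ z in cone x, ‖F z‖ₑ ^ q.toReal ∂coneMeasure μ := by
  rw [lusin, eLpNorm_eq_lintegral_rpow_enorm_toReal hq0 hq, ← ENNReal.rpow_mul,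
    one_div_mul_cancel (ENNReal.toReal_pos hq0 hq).ne', ENNReal.rpow_one]

theorem measurable_lusin [BorelSpace X] {μ : Measure X} (q : ℝ≥0∞) (F : X × ℝ → ℂ) :
    Measurable (lusin μ q F) :=
  (lowerSemicontinuous_lusin μ q F).measurable

variable (μ : Measure X) [hμ : Nondegenerate μ]

theorem sigmaFinite_halfMeasure : SigmaFinite (halfMeasure μ) := by
  have := sigmaFinite_of_nondegenerate μ
  have : SigmaFinite ((volume.restrict (Ioi (0 : ℝ))).withDensity fun t => ENNReal.ofReal t⁻¹) :=
    SigmaFinite.withDensity_ofReal _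
  unfold halfMeasure
  infer_instance

theorem ae_halfMeasure_pos : ∀ᵐ z ∂halfMeasure μ, 0 < z.2 := by
  have := sigmaFinite_of_nondegenerate μ
  have : SigmaFinite ((volume.restrict (Ioi (0 : ℝ))).withDensity fun t => ENNReal.ofReal t⁻¹) :=
    SigmaFinite.withDensity_ofReal _
  have hpos : ∀ᵐ t ∂((volume.restrict (Ioi (0 : ℝ))).withDensity fun t => ENNReal.ofReal t⁻¹),
      0 < t := (withDensity_absolutelyContinuous _ _).ae_le (ae_restrict_mem measurableSet_Ioi)
  exact Measure.quasiMeasurePreserving_snd.ae hpos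

variable {μ} in
theorem enorm_volPow (s : ℝ) (f : X × ℝ → ℂ) {z : X × ℝ} (hz : 0 < z.2) :
    ‖volPow μ s f z‖ₑ = μ (ball z.1 z.2) ^ s * ‖f z‖ₑ := by
  have hfin := (hμ.lt_top z.1 z.2 hz).ne
  have hpos : 0 < μ.real (ball z.1 z.2) := ENNReal.toReal_pos (hμ.pos z.1 z.2 hz).ne' hfin
  rw [volPow, enorm_mul, ← ofReal_norm, Complex.norm_real, Real.norm_of_nonneg (by positivity),
    ← ENNReal.ofReal_rpow_of_pos hpos, ofReal_measureReal hfin]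

variable [BorelSpace X]

include hμ in
theorem measurableSet_tent (B : Set X) : MeasurableSet (tent B) := by
  have := secondCountable_of_nondegenerate μ
  have hset : {z : X × ℝ | ball z.1 z.2 ⊆ B} = ⋂ x ∈ Bᶜ, {z : X × ℝ | z.2 ≤ dist x z.1} := by
    ext z
    simp only [mem_ofPred_eq, mem_iInter, subset_def, mem_ball, mem_compl_iff]
    exact forall_congr' fun x => by rw [← not_lt, not_imp_not]
  have hclosed : IsClosed {z : X × ℝ | ball z.1 z.2 ⊆ B} :=
    hset ▸ isClosed_biInter fun x _ => isClosed_le (by fun_prop) (by fun_prop)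
  exact (measurableSet_lt measurable_const measurable_snd).inter hclosed.measurableSet

include hμ in
theorem measurableSet_cone (x : X) : MeasurableSet (cone x) := by
  have := secondCountable_of_nondegenerate μ
  exact measurableSet_lt (f := fun z : X × ℝ => dist z.1 x) (by fun_prop) (by fun_prop)

theorem measurable_volume_ball_inter {S : Set X} (hS : MeasurableSet S) :
    Measurable fun z : X × ℝ => μ (ball z.1 z.2 ∩ S) := by
  have := sigmaFinite_of_nondegenerate μ
  have := secondCountable_of_nondegenerate μ
  have hset : MeasurableSet {w : (X × ℝ) × X | dist w.2 w.1.1 < w.1.2 ∧ w.2 ∈ S} :=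
    (measurableSet_lt (f := fun w : (X × ℝ) × X => dist w.2 w.1.1) (g := fun w => w.1.2)
      (by fun_prop) (by fun_prop)).inter (measurable_snd hS)
  exact measurable_measure_prodMk_left hset

variable {μ}

theorem measurable_volPow (s : ℝ) {f : X × ℝ → ℂ} (hf : Measurable f) :
    Measurable (volPow μ s f) :=
  (Complex.measurable_ofReal.comp
    ((measurable_volume_ball μ).ennreal_toReal.pow_const s)).mul hf

theorem setLIntegral_lintegral_cone {H : X × ℝ → ℝ≥0∞} (hH : Measurable H) (S : Set X) :
    ∫⁻ x in S, ∫⁻ z in cone x, H z ∂coneMeasure μ ∂μ =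
      ∫⁻ z, (μ (ball z.1 z.2))⁻¹ * H z * μ (ball z.1 z.2 ∩ S) ∂halfMeasure μ := by
  have := sigmaFinite_of_nondegenerate μ
  have := sigmaFinite_halfMeasure μ
  have := secondCountable_of_nondegenerate μ
  set W : X × ℝ → ℝ≥0∞ := fun z => (μ (ball z.1 z.2))⁻¹ * H z
  have hWm : Measurable W := (measurable_volume_ball μ).inv.mul hH
  have hcone (x : X) : ∫⁻ z in cone x, H z ∂coneMeasure μ =
      ∫⁻ z, (cone x).indicator W z ∂halfMeasure μ := by
    rw [coneMeasure, lintegral_indicator (measurableSet_cone μ x)]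
    exact setLIntegral_withDensity_eq_setLIntegral_mul _ (measurable_volume_ball μ).inv hH
      (measurableSet_cone μ x)
  have hset : MeasurableSet {w : X × (X × ℝ) | dist w.2.1 w.1 < w.2.2} :=
    measurableSet_lt (by fun_prop) (by fun_prop)
  have hmeas : Measurable (Function.uncurry fun (x : X) (z : X × ℝ) => (cone x).indicator W z) :=
    (hWm.comp (measurable_snd (α := X))).indicator hset
  simp only [hcone]
  rw [lintegral_lintegral_swap hmeas.aemeasurable]
  refine lintegral_congr fun z => ?_
  have hswap (x : X) : (cone x).indicator W z = (ball z.1 z.2).indicator (fun _ => W z) x :=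
    indicator_eq_indicator (mem_ball_comm (x := z.1) (y := x)) rfl
  simp only [hswap]
  rw [lintegral_indicator measurableSet_ball, setLIntegral_const,
    Measure.restrict_apply measurableSet_ball]

theorem lintegral_le_two_mul_setLIntegral_cone {H : X × ℝ → ℝ≥0∞} (hH : Measurable H) {S : Set X}
    (hS : ∀ z, 0 < z.2 → H z ≠ 0 → μ (ball z.1 z.2) ≤ 2 * μ (ball z.1 z.2 ∩ S)) :
    ∫⁻ z, H z ∂halfMeasure μ ≤ 2 * ∫⁻ x in S, ∫⁻ z in cone x, H z ∂coneMeasure μ ∂μ := by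
  rw [setLIntegral_lintegral_cone hH, ← lintegral_const_mul' _ _ (by simp)]
  refine lintegral_mono_ae ?_
  filter_upwards [ae_halfMeasure_pos μ] with z hz
  rcases eq_or_ne (H z) 0 with hHz | hHz
  · simp [hHz]
  calc H z = (μ (ball z.1 z.2))⁻¹ * H z * μ (ball z.1 z.2) := by
        rw [mul_right_comm, ENNReal.inv_mul_cancel (hμ.pos _ _ hz).ne' (hμ.lt_top _ _ hz).ne,
          one_mul]
    _ ≤ (μ (ball z.1 z.2))⁻¹ * H z * (2 * μ (ball z.1 z.2 ∩ S)) := by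
        gcongr
        exact hS z hz hHz
    _ = 2 * ((μ (ball z.1 z.2))⁻¹ * H z * μ (ball z.1 z.2 ∩ S)) := by ring

end HalfSpace

section VitaliTents

variable {X : Type*} [MetricSpace X] [MeasurableSpace X] [BorelSpace X] {μ : Measure X}
  [hμ : Nondegenerate μ]

variable (μ) in
include hμ in
theorem exists_countable_tent_cover {E : Set (X × ℝ)} (hpos : ∀ z ∈ E, 0 < z.2) {R : ℝ}
    (hR : ∀ z ∈ E, z.2 ≤ R) :
    ∃ u ⊆ E, u.Countable ∧ u.PairwiseDisjoint (fun z => ball z.1 z.2) ∧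
      E ⊆ ⋃ b ∈ u, tent (ball b.1 (5 * b.2)) := by
  have := secondCountable_of_nondegenerate μ
  obtain ⟨u, huE, hdisj, hcov⟩ := Vitali.exists_disjoint_subfamily_covering_enlargement
    (fun z : X × ℝ => ball z.1 z.2) E (fun z => z.2) 2 one_lt_two (fun z hz => (hpos z hz).le) R hR
    (fun z hz => nonempty_ball.2 (hpos z hz))
  refine ⟨u, huE, hdisj.countable_of_isOpen (fun _ _ => isOpen_ball)
    (fun z hz => nonempty_ball.2 (hpos z (huE hz))), hdisj, fun z hz => ?_⟩
  obtain ⟨b, hb, ⟨x, hxz, hxb⟩, hle⟩ := hcov z hz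
  refine mem_iUnion₂.2 ⟨b, hb, hpos z hz, fun y hy => ?_⟩
  rw [mem_ball] at hxz hxb hy ⊢
  linarith [dist_triangle y z.1 b.1, dist_triangle z.1 x b.1, dist_comm z.1 x]

variable {ν : Measure (X × ℝ)} {D : ℝ≥0}
  (hD : ∀ (x : X) (r : ℝ), 0 < r → μ (ball x (5 * r)) ≤ D * μ (ball x r)) {P : ℝ} (hP : 1 ≤ P)
  {E : Set (X × ℝ)} (hpos : ∀ z ∈ E, 0 < z.2) {O : Set X} (hO : MeasurableSet O)
  (hEO : ∀ z ∈ E, μ (ball z.1 z.2) ≤ 2 * μ (ball z.1 z.2 ∩ O)) {H : X × ℝ → ℝ≥0∞} {K : ℝ≥0∞}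
  (htent : ∀ (c : X) (r : ℝ), 0 < r →
    ∫⁻ z in E ∩ tent (ball c r), H z ∂ν ≤ K * μ (ball c r) ^ P)

include hD hP hpos hO hEO htent

theorem setLIntegral_le_of_forall_tent_of_bounded {R : ℝ} (hR : ∀ z ∈ E, z.2 ≤ R) :
    ∫⁻ z in E, H z ∂ν ≤ K * (2 * D * μ O) ^ P := by
  obtain ⟨u, huE, hu, hdisj, hcov⟩ := exists_countable_tent_cover μ hpos hR
  have : Countable u := hu
  calc ∫⁻ z in E, H z ∂ν
      ≤ ∫⁻ z in ⋃ b : u, E ∩ tent (ball b.1.1 (5 * b.1.2)), H z ∂ν := by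
        refine lintegral_mono_set fun z hz => ?_
        obtain ⟨b, hb, hzb⟩ := mem_iUnion₂.1 (hcov hz)
        exact mem_iUnion.2 ⟨⟨b, hb⟩, hz, hzb⟩
    _ ≤ ∑' b : u, ∫⁻ z in E ∩ tent (ball b.1.1 (5 * b.1.2)), H z ∂ν := lintegral_iUnion_le _ _
    _ ≤ ∑' b : u, K * (2 * D * μ (ball b.1.1 b.1.2 ∩ O)) ^ P := by
        refine ENNReal.tsum_le_tsum fun b => ?_
        have hb := hpos _ (huE b.2)
        refine (htent b.1.1 (5 * b.1.2) (by positivity)).trans ?_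
        gcongr
        refine (hD _ _ hb).trans ?_
        rw [mul_comm 2, mul_assoc]
        gcongr
        exact hEO _ (huE b.2)
    _ ≤ K * (∑' b : u, 2 * D * μ (ball b.1.1 b.1.2 ∩ O)) ^ P := by
        rw [ENNReal.tsum_mul_left]
        gcongr
        exact tsum_rpow_le_rpow_tsum _ hP
    _ ≤ K * (2 * D * μ O) ^ P := by
        rw [ENNReal.tsum_mul_left, ← measure_iUnion]
        · gcongr
          exact iUnion_subset fun b => inter_subset_right
        · exact fun b c hbc => (hdisj b.2 c.2 (Subtype.coe_ne_coe.2 hbc)).mono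
            inter_subset_left inter_subset_left
        · exact fun b => measurableSet_ball.inter hO

theorem setLIntegral_le_of_forall_tent : ∫⁻ z in E, H z ∂ν ≤ K * (2 * D * μ O) ^ P := by
  have hunion : E = ⋃ n : ℕ, E ∩ {z | z.2 ≤ n} := by
    rw [← inter_iUnion, inter_eq_left.2]
    exact fun z _ => mem_iUnion.2 (exists_nat_ge z.2)
  have hmono : Monotone fun n : ℕ => E ∩ {z | z.2 ≤ n} := fun n k hnk =>
    inter_subset_inter_right _ fun z (hz : z.2 ≤ n) => hz.trans (Nat.cast_le.2 hnk)
  rw [hunion, setLIntegral_iUnion_of_directed _ hmono.directed_le]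
  refine iSup_le fun n => ?_
  refine setLIntegral_le_of_forall_tent_of_bounded hD hP (fun z hz => hpos z hz.1) hO
    (fun z hz => hEO z hz.1) (fun c r hr => (lintegral_mono_set ?_).trans (htent c r hr))
    (fun z hz => hz.2)
  exact inter_subset_inter_left _ inter_subset_left

end VitaliTents

section BallMedian

variable {X : Type*} [MetricSpace X] [MeasurableSpace X] {μ : Measure X}
  {A : X → ℝ≥0∞} {a : ℝ≥0∞} {z : X × ℝ}

variable (μ A z) in
/-- The upper median of `A` over the ball `B(y,t)`, as a function of `z = (y,t)`. -/
noncomputable def ballMedian : ℝ≥0∞ := upperMedian (μ.restrict (ball z.1 z.2)) A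

theorem ballMedian_le_iff (hA : Measurable A) :
    ballMedian μ A z ≤ a ↔ 2 * μ (ball z.1 z.2 ∩ {x | a < A x}) ≤ μ (ball z.1 z.2) := by
  rw [ballMedian, upperMedian_le_iff, Measure.restrict_apply_univ,
    Measure.restrict_apply (measurableSet_lt measurable_const hA), inter_comm]

variable [hμ : Nondegenerate μ]

theorem measurable_ballMedian [BorelSpace X] (hA : Measurable A) : Measurable (ballMedian μ A) := by
  refine measurable_of_Iic fun a => ?_
  have hset : ballMedian μ A ⁻¹' Iic a =
      {z | 2 * μ (ball z.1 z.2 ∩ {x | a < A x}) ≤ μ (ball z.1 z.2)} :=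
    Set.ext fun z => ballMedian_le_iff hA
  rw [hset]
  exact measurableSet_le ((measurable_volume_ball_inter μ
    (measurableSet_lt measurable_const hA)).const_mul 2) (measurable_volume_ball μ)

theorem measure_ball_le_of_ballMedian_le (hz : 0 < z.2) (hA : Measurable A)
    (ha : ballMedian μ A z ≤ a) : μ (ball z.1 z.2) ≤ 2 * μ (ball z.1 z.2 ∩ {x | A x ≤ a}) := by
  have : IsFiniteMeasure (μ.restrict (ball z.1 z.2)) :=
    isFiniteMeasure_restrict.2 (hμ.lt_top _ _ hz).ne
  have h := measure_univ_le_two_mul_of_upperMedian_le hA ha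
  rwa [Measure.restrict_apply_univ, Measure.restrict_apply (measurableSet_le hA measurable_const),
    inter_comm] at h

theorem ballMedian_lt_top (hz : 0 < z.2) (hA : Measurable A) (hAfin : ∀ᵐ x ∂μ, A x < ∞) :
    ballMedian μ A z < ∞ := by
  have : IsFiniteMeasure (μ.restrict (ball z.1 z.2)) :=
    isFiniteMeasure_restrict.2 (hμ.lt_top _ _ hz).ne
  have : NeZero (μ.restrict (ball z.1 z.2)) :=
    ⟨Measure.restrict_eq_zero.not.2 (hμ.pos _ _ hz).ne'⟩
  exact upperMedian_lt_top hA (ae_restrict_of_ae hAfin)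

end BallMedian

section CarlesonDuality

variable {X : Type*} [MetricSpace X] [MeasurableSpace X] [BorelSpace X] {μ : Measure X}
  [hμ : Nondegenerate μ] {q : ℝ≥0∞} {F : X × ℝ → ℂ} {a : ℝ≥0∞} {E : Set (X × ℝ)}

theorem setLIntegral_inter_tent_le (hq0 : q ≠ 0) (hq : q ≠ ∞) (hF : Measurable F)
    (hE : MeasurableSet E) (hEa : ∀ z ∈ E, ballMedian μ (lusin μ q F) z ≤ a) {B : Set X}
    (hB : MeasurableSet B) :
    ∫⁻ z in E ∩ tent B, ‖F z‖ₑ ^ q.toReal ∂halfMeasure μ ≤ 2 * (a ^ q.toReal * μ B) := by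
  have hA : Measurable (lusin μ q F) := measurable_lusin q F
  have hET : MeasurableSet (E ∩ tent B) := hE.inter (measurableSet_tent μ B)
  set H : X × ℝ → ℝ≥0∞ := (E ∩ tent B).indicator fun z => ‖F z‖ₑ ^ q.toReal
  rw [← lintegral_indicator hET]
  calc ∫⁻ z, H z ∂halfMeasure μ
      ≤ 2 * ∫⁻ x in {x | lusin μ q F x ≤ a}, ∫⁻ z in cone x, H z ∂coneMeasure μ ∂μ :=
        lintegral_le_two_mul_setLIntegral_cone ((hF.enorm.pow_const _).indicator hET)
          fun z hz hHz => measure_ball_le_of_ballMedian_le hz hA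
            (hEa z (mem_of_indicator_ne_zero hHz).1)
    _ ≤ 2 * ∫⁻ x in {x | lusin μ q F x ≤ a}, B.indicator (fun _ => a ^ q.toReal) x ∂μ := by
        gcongr 2 * ?_
        refine setLIntegral_mono' (measurableSet_le hA measurable_const)
          fun x (hx : lusin μ q F x ≤ a) => ?_
        by_cases hxB : x ∈ B
        · rw [indicator_of_mem hxB]
          calc ∫⁻ z in cone x, H z ∂coneMeasure μ
              ≤ ∫⁻ z in cone x, ‖F z‖ₑ ^ q.toReal ∂coneMeasure μ :=
                lintegral_mono fun z => indicator_le_self _ _ z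
            _ = lusin μ q F x ^ q.toReal := (lusin_rpow hq0 hq F x).symm
            _ ≤ a ^ q.toReal := by gcongr
        · refine (setLIntegral_eq_zero (measurableSet_cone μ x) fun z hz => ?_).trans_le zero_le
          exact indicator_of_notMem (fun h => hxB (mem_of_mem_cone_of_mem_tent hz h.2)) _
    _ ≤ 2 * ∫⁻ x, B.indicator (fun _ => a ^ q.toReal) x ∂μ := by
        gcongr
        exact Measure.restrict_le_self
    _ = 2 * (a ^ q.toReal * μ B) := by rw [lintegral_indicator_const hB]

theorem eLpNorm_restrict_inter_tent_le (hq1 : 1 ≤ q) (hq : q ≠ ∞) (hF : Measurable F)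
    (hE : MeasurableSet E) (hEa : ∀ z ∈ E, ballMedian μ (lusin μ q F) z ≤ a) {B : Set X}
    (hB : MeasurableSet B) :
    eLpNorm F q ((halfMeasure μ).restrict (E ∩ tent B)) ≤ 2 * a * μ B ^ (1 / q.toReal) := by
  have hq0 : q ≠ 0 := (zero_lt_one.trans_le hq1).ne'
  have hr : 1 ≤ q.toReal := by simpa using ENNReal.toReal_mono hq hq1
  calc eLpNorm F q ((halfMeasure μ).restrict (E ∩ tent B))
      ≤ (2 * (a ^ q.toReal * μ B)) ^ (1 / q.toReal) := by
        rw [eLpNorm_eq_lintegral_rpow_enorm_toReal hq0 hq]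
        gcongr
        exact setLIntegral_inter_tent_le hq0 hq hF hE hEa hB
    _ = 2 ^ (1 / q.toReal) * a * μ B ^ (1 / q.toReal) := by
        rw [ENNReal.mul_rpow_of_nonneg _ _ (by positivity),
          ENNReal.mul_rpow_of_nonneg _ _ (by positivity), ← ENNReal.rpow_mul,
          mul_one_div_cancel (by positivity), ENNReal.rpow_one, mul_assoc]
    _ ≤ 2 * a * μ B ^ (1 / q.toReal) := by
        gcongr
        exact (ENNReal.rpow_le_rpow_of_exponent_le one_le_two (div_le_self zero_le_one hr)).trans_eq
          (ENNReal.rpow_one 2)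

variable {q' : ℝ≥0∞} [hqq' : ENNReal.HolderConjugate q q'] {G : X × ℝ → ℂ} {N : ℝ≥0∞} {P : ℝ}
  {D : ℝ≥0} (hD : ∀ (x : X) (r : ℝ), 0 < r → μ (ball x (5 * r)) ≤ D * μ (ball x r))
  (hq : q ≠ ∞) (hP : 1 ≤ P) (hF : Measurable F) (hG : Measurable G)
  (hN : ∀ (c : X) (r : ℝ), 0 < r → eLpNorm G q' ((halfMeasure μ).restrict (tent (ball c r))) ≤
    N * μ (ball c r) ^ (P - 1 / q.toReal))

include hD hq hP hF hG hN

theorem setLIntegral_enorm_mul_enorm_le_of_ballMedian_le (hE : MeasurableSet E)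
    (hpos : ∀ z ∈ E, 0 < z.2) (hEa : ∀ z ∈ E, ballMedian μ (lusin μ q F) z ≤ a) {O : Set X}
    (hO : MeasurableSet O) (hEO : ∀ z ∈ E, μ (ball z.1 z.2) ≤ 2 * μ (ball z.1 z.2 ∩ O)) :
    ∫⁻ z in E, ‖F z‖ₑ * ‖G z‖ₑ ∂halfMeasure μ ≤ 2 * a * N * (2 * D * μ O) ^ P := by
  have hq1 : 1 ≤ q := hqq'.one_le
  have hr : 1 ≤ q.toReal := by simpa using ENNReal.toReal_mono hq hq1
  have hPq : 0 ≤ P - 1 / q.toReal := by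
    linarith [div_le_self zero_le_one hr]
  refine setLIntegral_le_of_forall_tent hD hP hpos hO hEO fun c r hr => ?_
  calc ∫⁻ z in E ∩ tent (ball c r), ‖F z‖ₑ * ‖G z‖ₑ ∂halfMeasure μ
      ≤ eLpNorm F q ((halfMeasure μ).restrict (E ∩ tent (ball c r))) *
          eLpNorm G q' ((halfMeasure μ).restrict (E ∩ tent (ball c r))) :=
        lintegral_enorm_mul_enorm_le hF.aestronglyMeasurable hG.aestronglyMeasurable
    _ ≤ 2 * a * μ (ball c r) ^ (1 / q.toReal) * (N * μ (ball c r) ^ (P - 1 / q.toReal)) := by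
        gcongr
        · exact eLpNorm_restrict_inter_tent_le hq1 hq hF hE hEa measurableSet_ball
        · exact (eLpNorm_mono_measure _ (Measure.restrict_mono_set _ inter_subset_right)).trans
            (hN c r hr)
    _ = 2 * a * N * (μ (ball c r) ^ (1 / q.toReal) * μ (ball c r) ^ (P - 1 / q.toReal)) := by
        ring
    _ = 2 * a * N * μ (ball c r) ^ P := by
        rw [← ENNReal.rpow_add_of_nonneg _ _ (by positivity) hPq, add_sub_cancel]

theorem setLIntegral_enorm_mul_enorm_le_of_ballMedian_mem_Ioc (k : ℤ) :
    ∫⁻ z in {z | 0 < z.2 ∧ ballMedian μ (lusin μ q F) z ∈ Ioc (2 ^ k) (2 ^ (k + 1))},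
      ‖F z‖ₑ * ‖G z‖ₑ ∂halfMeasure μ ≤
        4 * N * (2 * D) ^ P * (2 ^ k * μ {x | 2 ^ k < lusin μ q F x} ^ P) := by
  have hA : Measurable (lusin μ q F) := measurable_lusin q F
  refine (setLIntegral_enorm_mul_enorm_le_of_ballMedian_le hD hq hP hF hG hN
    ((measurableSet_lt measurable_const measurable_snd).inter
      (measurable_ballMedian hA measurableSet_Ioc)) (fun z hz => hz.1) (fun z hz => hz.2.2)
    (measurableSet_lt measurable_const hA)
    (fun z hz => (not_le.1 (mt (ballMedian_le_iff hA).2 hz.2.1.not_ge)).le)).trans_eq ?_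
  rw [ENNReal.mul_rpow_of_nonneg _ _ (by positivity), ENNReal.zpow_add (by simp) (by simp),
    zpow_one]
  ring

theorem setLIntegral_enorm_mul_enorm_eq_zero_of_ballMedian_eq_zero :
    ∫⁻ z in {z | 0 < z.2 ∧ ballMedian μ (lusin μ q F) z = 0},
      ‖F z‖ₑ * ‖G z‖ₑ ∂halfMeasure μ = 0 := by
  refine le_antisymm ((setLIntegral_enorm_mul_enorm_le_of_ballMedian_le (a := 0) hD hq hP hF hG hN
    ((measurableSet_lt measurable_const measurable_snd).inter
      (measurable_ballMedian (measurable_lusin q F) (measurableSet_singleton 0)))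
    (fun z hz => hz.1) (fun z hz => (show _ = _ from hz.2).le) .univ
    (fun z _ => by rw [inter_univ, two_mul]; exact le_self_add)).trans_eq (by simp)) zero_le

theorem lintegral_enorm_mul_enorm_le_tsum (hfin : ∀ᵐ x ∂μ, lusin μ q F x < ∞) :
    ∫⁻ z, ‖F z‖ₑ * ‖G z‖ₑ ∂halfMeasure μ ≤
      ∑' k : ℤ, 4 * N * (2 * D) ^ P * (2 ^ k * μ {x | 2 ^ k < lusin μ q F x} ^ P) := by
  set m : X × ℝ → ℝ≥0∞ := ballMedian μ (lusin μ q F)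
  set E : ℤ → Set (X × ℝ) := fun k => {z | 0 < z.2 ∧ m z ∈ Ioc (2 ^ k) (2 ^ (k + 1))}
  have hcover : ∀ᵐ z ∂halfMeasure μ, z ∈ {z | 0 < z.2 ∧ m z = 0} ∪ ⋃ k, E k := by
    filter_upwards [ae_halfMeasure_pos μ] with z hz
    rcases eq_or_ne (m z) 0 with h0 | h0
    · exact .inl ⟨hz, h0⟩
    · obtain ⟨k, hk⟩ := ENNReal.exists_mem_Ioc_zpow h0
        (ballMedian_lt_top hz (measurable_lusin q F) hfin).ne ENNReal.one_lt_two
        ENNReal.ofNat_ne_top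
      exact .inr (mem_iUnion.2 ⟨k, hz, hk⟩)
  calc ∫⁻ z, ‖F z‖ₑ * ‖G z‖ₑ ∂halfMeasure μ
      = ∫⁻ z in {z | 0 < z.2 ∧ m z = 0} ∪ ⋃ k, E k, ‖F z‖ₑ * ‖G z‖ₑ ∂halfMeasure μ := by
        rw [Measure.restrict_eq_self_of_ae_mem hcover]
    _ ≤ ∫⁻ z in ⋃ k, E k, ‖F z‖ₑ * ‖G z‖ₑ ∂halfMeasure μ := by
        refine (lintegral_union_le _ _ _).trans_eq ?_
        rw [setLIntegral_enorm_mul_enorm_eq_zero_of_ballMedian_eq_zero hD hq hP hF hG hN, zero_add]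
    _ ≤ ∑' k, ∫⁻ z in E k, ‖F z‖ₑ * ‖G z‖ₑ ∂halfMeasure μ := lintegral_iUnion_le _ _
    _ ≤ _ := ENNReal.tsum_le_tsum
        (setLIntegral_enorm_mul_enorm_le_of_ballMedian_mem_Ioc hD hq hP hF hG hN)

omit hP hN in
theorem lintegral_enorm_mul_enorm_le_eLpNorm_lusin {p : ℝ≥0∞} (hp0 : p ≠ 0) (hp1 : p ≤ 1)
    (hN : ∀ (c : X) (r : ℝ), 0 < r → eLpNorm G q' ((halfMeasure μ).restrict (tent (ball c r))) ≤
      N * μ (ball c r) ^ (1 / p.toReal - 1 / q.toReal))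
    (hfin : eLpNorm (lusin μ q F) p μ < ∞) :
    ∫⁻ z, ‖F z‖ₑ * ‖G z‖ₑ ∂halfMeasure μ ≤
      4 * (2 * D) ^ (1 / p.toReal) * (1 - 2 ^ (-p.toReal))⁻¹ ^ (1 / p.toReal) * N *
        eLpNorm (lusin μ q F) p μ := by
  have hp : p ≠ ∞ := ne_top_of_le_ne_top ENNReal.one_ne_top hp1
  have hr : 0 < p.toReal := ENNReal.toReal_pos hp0 hp
  have hP : 1 ≤ 1 / p.toReal :=
    (one_le_div hr).2 (by simpa using ENNReal.toReal_mono ENNReal.one_ne_top hp1)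
  have hA : Measurable (lusin μ q F) := measurable_lusin q F
  have hAfin : ∀ᵐ x ∂μ, lusin μ q F x < ∞ := ae_lt_top_of_eLpNorm_lt_top hp0 hA hfin
  refine (lintegral_enorm_mul_enorm_le_tsum hD hq hP hF hG hN hAfin).trans ?_
  calc ∑' k : ℤ, 4 * N * (2 * D) ^ (1 / p.toReal) *
        (2 ^ k * μ {x | 2 ^ k < lusin μ q F x} ^ (1 / p.toReal))
      = 4 * N * (2 * D) ^ (1 / p.toReal) * ∑' k : ℤ,
          (((2 : ℝ≥0∞) ^ k) ^ p.toReal * μ {x | 2 ^ k < lusin μ q F x}) ^ (1 / p.toReal) := by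
        rw [ENNReal.tsum_mul_left]
        congr! 3 with k
        rw [ENNReal.mul_rpow_of_nonneg _ _ (by positivity), ← ENNReal.rpow_mul,
          mul_one_div_cancel hr.ne', ENNReal.rpow_one]
    _ ≤ 4 * N * (2 * D) ^ (1 / p.toReal) *
          ((1 - 2 ^ (-p.toReal))⁻¹ * ∫⁻ x, lusin μ q F x ^ p.toReal ∂μ) ^ (1 / p.toReal) := by
        gcongr
        refine (tsum_rpow_le_rpow_tsum _ hP).trans ?_
        gcongr
        exact tsum_zpow_rpow_mul_measure_lt_le hr hA
    _ = _ := by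
        rw [ENNReal.mul_rpow_of_nonneg _ (∫⁻ x, lusin μ q F x ^ p.toReal ∂μ) (by positivity),
          eLpNorm_eq_lintegral_rpow_enorm_toReal hp0 hp]
        simp only [enorm_eq_self]
        ring

end CarlesonDuality

section SolidSubmodule

open Filter Topology

variable {Ω : Type*} [MeasurableSpace Ω] {m : Measure Ω}

/-- A space of measurable functions is solid if it contains every measurable function dominated
almost everywhere, in absolute value, by one of its members. -/
def IsSolid (E : Submodule ℂ (Ω →ₘ[m] ℂ)) : Prop :=
  ∀ ⦃f e : Ω →ₘ[m] ℂ⦄, (∀ᵐ z ∂m, ‖f z‖ ≤ ‖e z‖) → e ∈ E → f ∈ E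

variable {E : Submodule ℂ (Ω →ₘ[m] ℂ)}

/-- A functional is order continuous if it tends to `0` along every sequence that is dominated by
a member of the space and tends to `0` almost everywhere. -/
def IsOrderContinuous (φ : Module.Dual ℂ E) : Prop :=
  ∀ ⦃f : ℕ → E⦄ ⦃e : E⦄, (∀ n, ∀ᵐ z ∂m, ‖(f n : Ω →ₘ[m] ℂ) z‖ ≤ ‖(e : Ω →ₘ[m] ℂ) z‖) →
    (∀ᵐ z ∂m, Tendsto (fun n => (f n : Ω →ₘ[m] ℂ) z) atTop (𝓝 0)) →
    Tendsto (fun n => φ (f n)) atTop (𝓝 0)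

theorem IsSolid.mul_mem (hE : IsSolid E) (h : Lp ℂ ∞ m) (e : E) : h.1 * e.1 ∈ E := by
  refine hE ?_ (E.smul_mem (‖h‖ : ℂ) e.2)
  filter_upwards [AEEqFun.coeFn_mul h.1 e.1, AEEqFun.coeFn_smul (‖h‖ : ℂ) e.1,
    ae_norm_le_norm_of_Lp_top h] with z hmul hsmul hz
  rw [hmul, hsmul, Pi.mul_apply, Pi.smul_apply, norm_mul, norm_smul, Complex.norm_real, norm_norm]
  gcongr

/-- Multiplication of a fixed member `e` of a solid space by bounded functions. -/
noncomputable def IsSolid.mulTop (hE : IsSolid E) (e : E) : Lp ℂ ∞ m →ₗ[ℂ] E where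
  toFun h := ⟨h.1 * e.1, hE.mul_mem h e⟩
  map_add' h k := by
    refine Subtype.ext (AEEqFun.ext ?_)
    filter_upwards [AEEqFun.coeFn_mul (h + k).1 e.1, AEEqFun.coeFn_add h.1 k.1,
      AEEqFun.coeFn_add (h.1 * e.1) (k.1 * e.1), AEEqFun.coeFn_mul h.1 e.1,
      AEEqFun.coeFn_mul k.1 e.1] with z hmul hadd hadd' hh hk
    refine hmul.trans (Eq.trans ?_ hadd'.symm)
    rw [Pi.add_apply, hh, hk, Pi.mul_apply, Pi.mul_apply, Pi.mul_apply, ← add_mul]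
    exact congrArg (· * _) hadd
  map_smul' c h := by
    refine Subtype.ext (AEEqFun.ext ?_)
    filter_upwards [AEEqFun.coeFn_mul (c • h).1 e.1, AEEqFun.coeFn_smul c h.1,
      AEEqFun.coeFn_smul c (h.1 * e.1), AEEqFun.coeFn_mul h.1 e.1] with z hmul hsmul hsmul' hh
    refine hmul.trans (Eq.trans ?_ hsmul'.symm)
    rw [Pi.smul_apply, hh, Pi.mul_apply, Pi.mul_apply, ← smul_mul_assoc]
    exact congrArg (· * _) hsmul

theorem IsSolid.coeFn_mulTop (hE : IsSolid E) (e : E) (h : Lp ℂ ∞ m) :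
    (hE.mulTop e h : Ω →ₘ[m] ℂ) =ᵐ[m] fun z => h z * (e : Ω →ₘ[m] ℂ) z :=
  AEEqFun.coeFn_mul h.1 e.1

theorem IsSolid.exists_mem_ae_norm_eq_add (hE : IsSolid E) (f w : E) :
    ∃ e : E, ∀ᵐ z ∂m,
      ‖(e : Ω →ₘ[m] ℂ) z‖ = ‖(f : Ω →ₘ[m] ℂ) z‖ + ‖(w : Ω →ₘ[m] ℂ) z‖ := by
  have habs (a : E) : ∃ b : E, ∀ᵐ z ∂m, (b : Ω →ₘ[m] ℂ) z = (‖(a : Ω →ₘ[m] ℂ) z‖ : ℂ) := by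
    have hm : AEStronglyMeasurable (fun z => (‖(a : Ω →ₘ[m] ℂ) z‖ : ℂ)) m :=
      Complex.continuous_ofReal.comp_aestronglyMeasurable a.1.aestronglyMeasurable.norm
    refine ⟨⟨AEEqFun.mk _ hm, hE ?_ a.2⟩, AEEqFun.coeFn_mk _ hm⟩
    filter_upwards [AEEqFun.coeFn_mk _ hm] with z hz
    rw [hz, Complex.norm_real, norm_norm]
  obtain ⟨f', hf'⟩ := habs f
  obtain ⟨w', hw'⟩ := habs w
  refine ⟨f' + w', ?_⟩
  filter_upwards [hf', hw', AEEqFun.coeFn_add f'.1 w'.1] with z hfz hwz hadd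
  rw [Submodule.coe_add, hadd, Pi.add_apply, hfz, hwz, ← Complex.ofReal_add, Complex.norm_real,
    Real.norm_of_nonneg (by positivity)]

theorem integrable_ae_eq_of_integralMul_eq {g g' : Ω → ℂ} (hg : Integrable g m)
    (hg' : Integrable g' m) (h : integralMul hg = integralMul hg') : g =ᵐ[m] g' := by
  refine hg.ae_eq_of_forall_setIntegral_eq _ _ hg' fun s hs _ => ?_
  have hind {k : Ω → ℂ} (hk : Integrable k m) :
      integralMul hk (indicatorTop m hs) = ∫ z in s, k z ∂m := by
    rw [← integral_indicator hs]
    refine integral_congr_ae ?_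
    filter_upwards [coeFn_indicatorTop (m := m) hs] with z hz
    by_cases hzs : z ∈ s <;> simp [hz, hzs]
  rw [← hind hg, ← hind hg', h]

variable {φ : Module.Dual ℂ E}

theorem IsOrderContinuous.isNormal_comp_mulTop (hφ : IsOrderContinuous φ) (hE : IsSolid E) (e : E) :
    IsNormal (φ ∘ₗ hE.mulTop e) := by
  intro h C hbdd hlim
  refine hφ (e := (C : ℂ) • e) (fun n => ?_) ?_
  · filter_upwards [hbdd n, hE.coeFn_mulTop e (h n), AEEqFun.coeFn_smul (C : ℂ) e.1]
      with z hz hmul hsmul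
    rw [hmul, Submodule.coe_smul, hsmul, Pi.smul_apply, norm_mul, norm_smul, Complex.norm_real,
      Real.norm_of_nonneg ((norm_nonneg _).trans hz)]
    gcongr
  · filter_upwards [hlim, ae_all_iff.2 fun n => hE.coeFn_mulTop e (h n)] with z hz hmul
    simpa only [hmul, zero_mul] using hz.mul_const _

theorem IsOrderContinuous.exists_comp_mulTop_eq_integralMul [SigmaFinite m]
    (hφ : IsOrderContinuous φ) (hE : IsSolid E) (e : E) :
    ∃ (k : Ω → ℂ) (hk : Integrable k m), φ ∘ₗ hE.mulTop e = integralMul hk :=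
  (hφ.isNormal_comp_mulTop hE e).exists_eq_integralMul

theorem density_ae_eq_div_mul_density (hE : IsSolid E) {a e : E}
    (hae : ∀ᵐ z ∂m, ‖(a : Ω →ₘ[m] ℂ) z‖ ≤ ‖(e : Ω →ₘ[m] ℂ) z‖) {k k' : Ω → ℂ}
    (hk : Integrable k m) (hk' : Integrable k' m) (hka : φ ∘ₗ hE.mulTop a = integralMul hk)
    (hke : φ ∘ₗ hE.mulTop e = integralMul hk') :
    k =ᵐ[m] fun z => (a : Ω →ₘ[m] ℂ) z / (e : Ω →ₘ[m] ℂ) z * k' z := by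
  set ρ : Ω → ℂ := fun z => (a : Ω →ₘ[m] ℂ) z / (e : Ω →ₘ[m] ℂ) z
  have hρm : AEStronglyMeasurable ρ m :=
    (a.1.aemeasurable.div e.1.aemeasurable).aestronglyMeasurable
  have hρ : MemLp ρ ∞ m := by
    refine memLp_top_of_bound hρm 1 ?_
    filter_upwards [hae] with z hz
    rw [norm_div]
    exact div_le_one_of_le₀ hz (norm_nonneg _)
  refine integrable_ae_eq_of_integralMul_eq hk (hk'.mul_of_top_right hρ) (LinearMap.ext fun h => ?_)
  have hhρ : MemLp (fun z => h z * ρ z) ∞ m := hρ.mul' (Lp.memLp h)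
  have hmul : hE.mulTop a h = hE.mulTop e (hhρ.toLp _) := by
    refine Subtype.ext (AEEqFun.ext ?_)
    filter_upwards [hE.coeFn_mulTop a h, hE.coeFn_mulTop e (hhρ.toLp _), hhρ.coeFn_toLp, hae]
      with z hza hze hzρ hz
    rw [hza, hze, hzρ, mul_assoc, div_mul_cancel_of_imp fun h0 => ?_]
    simpa [h0] using hz
  calc integralMul hk h = φ (hE.mulTop e (hhρ.toLp _)) := by
        rw [← hka, LinearMap.comp_apply, hmul]
    _ = ∫ z, (hhρ.toLp _) z * k' z ∂m := LinearMap.congr_fun hke _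
    _ = ∫ z, h z * (ρ z * k' z) ∂m := by
        refine integral_congr_ae ?_
        filter_upwards [hhρ.coeFn_toLp] with z hz
        rw [hz, mul_assoc]

theorem IsOrderContinuous.exists_forall_eq_integral_mul [SigmaFinite m] (hφ : IsOrderContinuous φ)
    (hE : IsSolid E) {w : E} (hw : ∀ᵐ z ∂m, (w : Ω →ₘ[m] ℂ) z ≠ 0) :
    ∃ g : Ω →ₘ[m] ℂ, ∀ f : E, Integrable (fun z => (f : Ω →ₘ[m] ℂ) z * g z) m ∧
      φ f = ∫ z, (f : Ω →ₘ[m] ℂ) z * g z ∂m := by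
  obtain ⟨kw, hkw, hφw⟩ := hφ.exists_comp_mulTop_eq_integralMul hE w
  have hgm : AEStronglyMeasurable (fun z => kw z / (w : Ω →ₘ[m] ℂ) z) m :=
    (hkw.aemeasurable.div w.1.aemeasurable).aestronglyMeasurable
  refine ⟨AEEqFun.mk _ hgm, fun f => ?_⟩
  obtain ⟨e, he⟩ := hE.exists_mem_ae_norm_eq_add f w
  obtain ⟨kf, hkf, hφf⟩ := hφ.exists_comp_mulTop_eq_integralMul hE f
  obtain ⟨ke, hke, hφe⟩ := hφ.exists_comp_mulTop_eq_integralMul hE e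
  have hkfe := density_ae_eq_div_mul_density hE
    (he.mono fun z hz => hz ▸ le_add_of_nonneg_right (norm_nonneg _)) hkf hke hφf hφe
  have hkwe := density_ae_eq_div_mul_density hE
    (he.mono fun z hz => hz ▸ le_add_of_nonneg_left (norm_nonneg _)) hkw hke hφw hφe
  have hfg : kf =ᵐ[m] fun z => (f : Ω →ₘ[m] ℂ) z * (AEEqFun.mk _ hgm : Ω →ₘ[m] ℂ) z := by
    filter_upwards [hkfe, hkwe, hw, AEEqFun.coeFn_mk _ hgm] with z hzf hzw hz hzg
    rw [hzf, hzg, hzw, div_mul_eq_mul_div ((w : Ω →ₘ[m] ℂ) z), div_right_comm,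
      mul_div_cancel_left₀ _ hz, div_mul_eq_mul_div, mul_div_assoc]
  refine ⟨hkf.congr hfg, ?_⟩
  have hone : hE.mulTop f (indicatorTop m .univ) = f := by
    refine Subtype.ext (AEEqFun.ext ?_)
    filter_upwards [hE.coeFn_mulTop f (indicatorTop m .univ), coeFn_indicatorTop (m := m) .univ]
      with z hz hz'
    rw [hz, hz', indicator_univ, one_mul]
  calc φ f = integralMul hkf (indicatorTop m .univ) := by
        rw [← hφf, LinearMap.comp_apply, hone]
    _ = ∫ z, kf z ∂m := by
        refine integral_congr_ae ?_
        filter_upwards [coeFn_indicatorTop (m := m) .univ] with z hz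
        rw [hz, indicator_univ, one_mul]
    _ = _ := integral_congr_ae hfg

theorem exists_ae_norm_le_mul_conj_eq (f g : Ω →ₘ[m] ℂ) :
    ∃ k : Ω →ₘ[m] ℂ, (∀ᵐ z ∂m, ‖k z‖ ≤ ‖f z‖) ∧
      ∀ᵐ z ∂m, k z * conj (g z) = ((‖f z‖ * ‖g z‖ : ℝ) : ℂ) := by
  have hm : AEStronglyMeasurable (fun z => (‖f z‖ : ℂ) * (g z / ‖g z‖)) m := by
    have hf := f.aemeasurable
    have hg := g.aemeasurable
    exact AEMeasurable.aestronglyMeasurable (by fun_prop)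
  refine ⟨AEEqFun.mk _ hm, ?_, ?_⟩ <;> filter_upwards [AEEqFun.coeFn_mk _ hm] with z hz
  · rw [hz, norm_mul, norm_div, Complex.norm_real, Complex.norm_real, norm_norm, norm_norm]
    exact mul_le_of_le_one_right (norm_nonneg _) (div_self_le_one _)
  · rw [hz, mul_assoc, div_mul_eq_mul_div, Complex.mul_conj', sq, mul_self_div_self,
      Complex.ofReal_mul]

theorem lintegral_enorm_mul_enorm_le_of_forall_enorm_integral_le {f g : Ω →ₘ[m] ℂ}
    (hfg : Integrable (fun z => f z * conj (g z)) m) {M : ℝ≥0∞}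
    (hM : ∀ k : Ω →ₘ[m] ℂ, (∀ᵐ z ∂m, ‖k z‖ ≤ ‖f z‖) → ‖∫ z, k z * conj (g z) ∂m‖ₑ ≤ M) :
    ∫⁻ z, ‖f z‖ₑ * ‖g z‖ₑ ∂m ≤ M := by
  obtain ⟨k, hkf, hkg⟩ := exists_ae_norm_le_mul_conj_eq f g
  refine le_of_eq_of_le ?_ (hM k hkf)
  calc ∫⁻ z, ‖f z‖ₑ * ‖g z‖ₑ ∂m = ∫⁻ z, ‖f z * conj (g z)‖ₑ ∂m := by
        simp only [enorm_mul, RCLike.enorm_conj]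
    _ = ENNReal.ofReal (∫ z, ‖f z * conj (g z)‖ ∂m) :=
        (ofReal_integral_norm_eq_lintegral_enorm hfg).symm
    _ = ‖((∫ z, ‖f z * conj (g z)‖ ∂m : ℝ) : ℂ)‖ₑ := by
        rw [← ofReal_norm, Complex.norm_real,
          Real.norm_of_nonneg (integral_nonneg fun z => norm_nonneg _)]
    _ = ‖∫ z, k z * conj (g z) ∂m‖ₑ := by
        rw [← integral_complex_ofReal]
        refine congrArg _ (integral_congr_ae ?_)
        filter_upwards [hkg] with z hz
        rw [hz, norm_mul, RCLike.norm_conj]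

end SolidSubmodule

section TentNorm

open Filter Topology

variable {X : Type*} [MetricSpace X] [MeasurableSpace X] {μ : Measure X} {p q : ℝ≥0∞}
  {F G : X × ℝ → ℂ}

theorem lusin_mono_ae (h : ∀ᵐ z ∂halfMeasure μ, ‖F z‖ ≤ ‖G z‖) (x : X) :
    lusin μ q F x ≤ lusin μ q G x :=
  eLpNorm_mono_ae ((restrict_coneMeasure_ac μ x).ae_le h)

theorem norm_volPow_le_norm_volPow (s : ℝ) {z : X × ℝ} (h : ‖F z‖ ≤ ‖G z‖) :
    ‖volPow μ s F z‖ ≤ ‖volPow μ s G z‖ := by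
  rw [volPow, volPow, norm_mul, norm_mul]
  gcongr

theorem tentNorm_mono_ae {s : ℝ} {f g : L0 μ} (h : ∀ᵐ z ∂halfMeasure μ, ‖f z‖ ≤ ‖g z‖) :
    tentNorm μ p q s f ≤ tentNorm μ p q s g :=
  eLpNorm_mono_enorm fun x =>
    lusin_mono_ae (h.mono fun _ hz => norm_volPow_le_norm_volPow (-s) hz) x

theorem tendsto_lusin_zero_of_dominated (hq : q ≠ ∞) {F : ℕ → X × ℝ → ℂ}
    (hF : ∀ n, AEMeasurable (F n) (halfMeasure μ))
    (hFG : ∀ n, ∀ᵐ z ∂halfMeasure μ, ‖F n z‖ ≤ ‖G z‖)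
    (hlim : ∀ᵐ z ∂halfMeasure μ, Tendsto (fun n => F n z) atTop (𝓝 0)) {x : X}
    (hG : lusin μ q G x < ∞) : Tendsto (fun n => lusin μ q (F n) x) atTop (𝓝 0) := by
  have hac := restrict_coneMeasure_ac μ x
  refine tendsto_eLpNorm_zero_of_dominated hq (fun n => ((hF n).mono_ac hac).enorm) hG
    (fun n => ?_) ?_
  · filter_upwards [hac.ae_le (hFG n)] with z hz using enorm_le_iff_norm_le.2 hz
  · filter_upwards [hac.ae_le hlim] with z hz
    simpa only [enorm_zero] using hz.enorm

variable [hμ : Nondegenerate μ]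

theorem enorm_volPow_neg_mul_enorm_volPow (s : ℝ) {z : X × ℝ} (hz : 0 < z.2) :
    ‖volPow μ (-s) F z‖ₑ * ‖volPow μ s G z‖ₑ = ‖F z‖ₑ * ‖G z‖ₑ := by
  have h0 := (hμ.pos z.1 z.2 hz).ne'
  have h1 := (hμ.lt_top z.1 z.2 hz).ne
  rw [enorm_volPow _ _ hz, enorm_volPow _ _ hz, mul_mul_mul_comm, ← ENNReal.rpow_add _ _ h0 h1,
    neg_add_cancel, ENNReal.rpow_zero, one_mul]

theorem lintegral_enorm_volPow_neg_mul_enorm_volPow (s : ℝ) (F G : X × ℝ → ℂ) :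
    ∫⁻ z, ‖volPow μ (-s) F z‖ₑ * ‖volPow μ s G z‖ₑ ∂halfMeasure μ =
      ∫⁻ z, ‖F z‖ₑ * ‖G z‖ₑ ∂halfMeasure μ :=
  lintegral_congr_ae
    ((ae_halfMeasure_pos μ).mono fun _ hz => enorm_volPow_neg_mul_enorm_volPow s hz)

variable [BorelSpace X]

theorem tendsto_tentNorm_zero_of_dominated (hp0 : p ≠ 0) (hp : p ≠ ∞) (hq : q ≠ ∞) {s : ℝ}
    {f : ℕ → L0 μ} {e : L0 μ} (hfe : ∀ n, ∀ᵐ z ∂halfMeasure μ, ‖f n z‖ ≤ ‖e z‖)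
    (hlim : ∀ᵐ z ∂halfMeasure μ, Tendsto (fun n => f n z) atTop (𝓝 0))
    (he : tentNorm μ p q s e < ∞) : Tendsto (fun n => tentNorm μ p q s (f n)) atTop (𝓝 0) := by
  have hdom (n) : ∀ᵐ z ∂halfMeasure μ, ‖volPow μ (-s) (f n) z‖ ≤ ‖volPow μ (-s) e z‖ :=
    (hfe n).mono fun _ hz => norm_volPow_le_norm_volPow (-s) hz
  refine tendsto_eLpNorm_zero_of_dominated hp (fun n => (measurable_lusin q _).enorm.aemeasurable)
    he (fun n => .of_forall (lusin_mono_ae (hdom n))) ?_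
  have hfin : ∀ᵐ x ∂μ, lusin μ q (volPow μ (-s) e) x < ∞ :=
    ae_lt_top_of_eLpNorm_lt_top hp0 (measurable_lusin q _) he
  filter_upwards [hfin] with x hx
  refine tendsto_lusin_zero_of_dominated hq
    (fun n => (aestronglyMeasurable_volPow (-s) (f n)).aemeasurable) hdom ?_ hx
  filter_upwards [hlim] with z hz
  simpa only [volPow, mul_zero] using hz.const_mul _

theorem isSolid_tentSpace (s : ℝ) : IsSolid (tentSpace μ p q s) := fun _ _ h he =>
  (tentNorm_mono_ae h).trans_lt he

theorem isOrderContinuous_of_mem_tentDual (hp0 : p ≠ 0) (hp : p ≠ ∞) (hq : q ≠ ∞) {s : ℝ}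
    (φ : tentDual μ p q s) : IsOrderContinuous (φ : Module.Dual ℂ (tentSpace μ p q s)) := by
  obtain ⟨C, hC⟩ := φ.2
  intro f e hfe hlim
  rw [tendsto_zero_iff_enorm_tendsto_zero]
  have h := ENNReal.Tendsto.const_mul (a := (C : ℝ≥0∞))
    (tendsto_tentNorm_zero_of_dominated hp0 hp hq hfe hlim e.2) (.inr ENNReal.coe_ne_top)
  rw [mul_zero] at h
  exact tendsto_of_tendsto_of_tendsto_of_le_of_le tendsto_const_nhds h (fun _ => zero_le)
    fun n => hC (f n)

theorem exists_volPow_ae_eq (s : ℝ) (hF : Measurable F) :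
    ∃ f : L0 μ, volPow μ s f =ᵐ[halfMeasure μ] F := by
  have hm := (measurable_volPow (μ := μ) (-s) hF).aestronglyMeasurable (μ := halfMeasure μ)
  refine ⟨AEEqFun.mk _ hm, ?_⟩
  filter_upwards [ae_halfMeasure_pos μ, AEEqFun.coeFn_mk _ hm] with z hz hmk
  have hV : 0 < μ.real (ball z.1 z.2) :=
    ENNReal.toReal_pos (hμ.pos z.1 z.2 hz).ne' (hμ.lt_top z.1 z.2 hz).ne
  rw [volPow, hmk, volPow, ← mul_assoc, ← Complex.ofReal_mul, ← Real.rpow_add hV, add_neg_cancel,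
    Real.rpow_zero, Complex.ofReal_one, one_mul]

theorem eLpNorm_lusin_self (hq0 : q ≠ 0) (hq : q ≠ ∞) (hF : Measurable F) :
    eLpNorm (lusin μ q F) q μ = eLpNorm F q (halfMeasure μ) := by
  rw [eLpNorm_eq_lintegral_rpow_enorm_toReal hq0 hq, eLpNorm_eq_lintegral_rpow_enorm_toReal hq0 hq]
  congr 1
  simp only [enorm_eq_self, lusin_rpow hq0 hq]
  rw [← setLIntegral_univ, setLIntegral_lintegral_cone (hF.enorm.pow_const _) univ]
  refine lintegral_congr_ae ?_
  filter_upwards [ae_halfMeasure_pos μ] with z hz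
  rw [inter_univ, mul_right_comm, ENNReal.inv_mul_cancel (hμ.pos z.1 z.2 hz).ne'
    (hμ.lt_top z.1 z.2 hz).ne, one_mul]

theorem support_lusin_subset {B : Set X} (hFB : Function.support F ⊆ tent B) :
    Function.support (lusin μ q F) ⊆ B := by
  refine fun x => not_imp_not.1 fun hxB => Function.notMem_support.2 ?_
  refine (eLpNorm_congr_ae (g := 0) ?_).trans eLpNorm_zero
  filter_upwards [ae_restrict_mem (measurableSet_cone μ x)] with z hz
  exact Function.notMem_support.1 fun h => hxB (mem_of_mem_cone_of_mem_tent hz (hFB h))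

theorem eLpNorm_lusin_le_of_support_subset_tent (hpq : p ≤ q) (hq0 : q ≠ 0) (hq : q ≠ ∞)
    (hF : Measurable F) {B : Set X} (hFB : Function.support F ⊆ tent B) :
    eLpNorm (lusin μ q F) p μ ≤
      eLpNorm F q (halfMeasure μ) * μ B ^ (1 / p.toReal - 1 / q.toReal) := by
  calc eLpNorm (lusin μ q F) p μ = eLpNorm (lusin μ q F) p (μ.restrict B) :=
        (eLpNorm_restrict_eq_of_support_subset (support_lusin_subset hFB)).symm
    _ ≤ eLpNorm (lusin μ q F) q (μ.restrict B) *
          (μ.restrict B) univ ^ (1 / p.toReal - 1 / q.toReal) :=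
        eLpNorm_le_eLpNorm_mul_rpow_measure_univ hpq (measurable_lusin q F).aestronglyMeasurable
    _ ≤ eLpNorm F q (halfMeasure μ) * μ B ^ (1 / p.toReal - 1 / q.toReal) := by
        rw [Measure.restrict_apply_univ, ← eLpNorm_lusin_self hq0 hq hF]
        gcongr
        exact Measure.restrict_le_self

end TentNorm

section Weight

variable {X : Type*} [MetricSpace X] [MeasurableSpace X] [BorelSpace X] (μ : Measure X)
  [hμ : Nondegenerate μ]

theorem exists_antitone_lintegral_dist_lt_top (x₀ : X) :
    ∃ e : ℝ → ℝ≥0∞, Antitone e ∧ (∀ r, 0 < e r) ∧ (∀ r, e r < ∞) ∧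
      ∫⁻ x, e (dist x x₀) ∂μ < ∞ := by
  obtain ⟨δ, hδ, hsum⟩ := ENNReal.exists_pos_tsum_mul_lt_of_countable one_ne_zero
    (fun n : ℕ => 1 + μ (ball x₀ (n + 1)))
    fun n => ENNReal.add_ne_top.2 ⟨ENNReal.one_ne_top, (hμ.lt_top x₀ _ (by positivity)).ne⟩
  refine ⟨fun r => ∑' n : ℕ, (Iio ((n : ℝ) + 1)).indicator (fun _ => (δ n : ℝ≥0∞)) r,
    fun r r' h => ?_, fun r => ?_, fun r => ?_, ?_⟩
  · refine ENNReal.tsum_le_tsum fun n => indicator_apply_le' (fun hr' => ?_) fun _ => zero_le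
    rw [indicator_of_mem (mem_Iio.2 (h.trans_lt hr'))]
  · obtain ⟨n, hn⟩ := exists_nat_gt r
    refine lt_of_lt_of_le ?_ (ENNReal.le_tsum n)
    rw [indicator_of_mem (mem_Iio.2 (hn.trans (lt_add_one _)))]
    exact ENNReal.coe_pos.2 (hδ n)
  · refine (ENNReal.tsum_le_tsum fun n => ?_).trans_lt (hsum.trans ENNReal.one_lt_top)
    exact (indicator_le_self _ _ _).trans (le_mul_of_one_le_left zero_le le_self_add)
  · calc ∫⁻ x, ∑' n : ℕ, (Iio ((n : ℝ) + 1)).indicator (fun _ => (δ n : ℝ≥0∞)) (dist x x₀) ∂μ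
        = ∫⁻ x, ∑' n : ℕ, (ball x₀ (n + 1)).indicator (fun _ => (δ n : ℝ≥0∞)) x ∂μ := rfl
      _ = ∑' n : ℕ, δ n * μ (ball x₀ (n + 1)) := by
          rw [lintegral_tsum fun n => (measurable_const.indicator measurableSet_ball).aemeasurable]
          exact tsum_congr fun n => lintegral_indicator_const measurableSet_ball _
      _ ≤ ∑' n : ℕ, (1 + μ (ball x₀ (n + 1))) * δ n :=
          ENNReal.tsum_le_tsum fun n => by rw [mul_comm]; gcongr; exact le_add_self
      _ < ∞ := hsum.trans ENNReal.one_lt_top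

theorem exists_setLIntegral_cone_le {e : ℝ → ℝ≥0∞} (he : Antitone e) (hepos : ∀ r, 0 < e r)
    (hetop : ∀ r, e r < ∞) (x₀ : X) :
    ∃ h : X × ℝ → ℝ≥0∞, Measurable h ∧ (∀ z, 0 < z.2 → 0 < h z ∧ h z < ∞) ∧
      ∀ x, ∫⁻ z in cone x, h z ∂coneMeasure μ ≤ e (dist x x₀) := by
  have := sigmaFinite_halfMeasure μ
  have := secondCountable_of_nondegenerate μ
  have hV := measurable_volume_ball μ
  obtain ⟨v, hvpos, hv, hvint⟩ := exists_pos_lintegral_lt_of_sigmaFinite (halfMeasure μ) one_ne_zero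
  have hhm : Measurable fun z : X × ℝ => μ (ball z.1 z.2) * (e (dist z.1 x₀ + z.2) * v z) :=
    hV.mul ((he.measurable.comp (by fun_prop)).mul hv.coe_nnreal_ennreal)
  refine ⟨_, hhm, fun z hz => ⟨?_, ?_⟩, fun x => ?_⟩
  · exact ENNReal.mul_pos (hμ.pos _ _ hz).ne'
      (mul_ne_zero (hepos _).ne' (ENNReal.coe_pos.2 (hvpos z)).ne')
  · exact ENNReal.mul_lt_top (hμ.lt_top _ _ hz) (ENNReal.mul_lt_top (hetop _) ENNReal.coe_lt_top)
  calc ∫⁻ z in cone x, μ (ball z.1 z.2) * (e (dist z.1 x₀ + z.2) * v z) ∂coneMeasure μ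
      = ∫⁻ z in cone x, (μ (ball z.1 z.2))⁻¹ *
          (μ (ball z.1 z.2) * (e (dist z.1 x₀ + z.2) * v z)) ∂halfMeasure μ :=
        setLIntegral_withDensity_eq_setLIntegral_mul _ hV.inv hhm (measurableSet_cone μ x)
    _ ≤ ∫⁻ z in cone x, e (dist x x₀) * v z ∂halfMeasure μ := by
        refine setLIntegral_mono' (measurableSet_cone μ x) fun z hz => ?_
        have hzx : dist z.1 x < z.2 := hz
        have hz0 : 0 < z.2 := dist_nonneg.trans_lt hzx
        rw [← mul_assoc, ENNReal.inv_mul_cancel (hμ.pos _ _ hz0).ne' (hμ.lt_top _ _ hz0).ne,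
          one_mul]
        gcongr
        refine he ?_
        linarith [dist_triangle_left x x₀ z.1]
    _ ≤ e (dist x x₀) * 1 := by
        rw [lintegral_const_mul _ hv.coe_nnreal_ennreal]
        gcongr
        exact (setLIntegral_le_lintegral _ _).trans hvint.le
    _ = e (dist x x₀) := mul_one _

variable {p q : ℝ≥0∞}

theorem exists_eLpNorm_lusin_lt_top [Nonempty X] (hp0 : p ≠ 0) (hp : p ≠ ∞) (hq0 : q ≠ 0)
    (hq : q ≠ ∞) : ∃ F : X × ℝ → ℂ, Measurable F ∧ (∀ z, 0 < z.2 → F z ≠ 0) ∧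
      eLpNorm (lusin μ q F) p μ < ∞ := by
  have hpr : 0 < p.toReal := ENNReal.toReal_pos hp0 hp
  have hqr : 0 < q.toReal := ENNReal.toReal_pos hq0 hq
  obtain ⟨x₀⟩ := ‹Nonempty X›
  obtain ⟨e, he, hepos, hetop, heint⟩ := exists_antitone_lintegral_dist_lt_top μ x₀
  obtain ⟨h, hhm, hh, hhe⟩ := exists_setLIntegral_cone_le μ
    (e := fun r => e r ^ (q.toReal / p.toReal))
    (fun r r' hr => ENNReal.rpow_le_rpow (he hr) (by positivity))
    (fun r => ENNReal.rpow_pos (hepos r) (hetop r).ne)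
    (fun r => ENNReal.rpow_lt_top_of_nonneg (by positivity) (hetop r).ne) x₀
  refine ⟨fun z => ((h z).toReal ^ (1 / q.toReal) : ℝ),
    Complex.measurable_ofReal.comp (hhm.ennreal_toReal.pow_const _), fun z hz => ?_, ?_⟩
  · exact Complex.ofReal_ne_zero.2
      (Real.rpow_pos_of_pos (ENNReal.toReal_pos (hh z hz).1.ne' (hh z hz).2.ne) _).ne'
  have hle (z) : ‖((((h z).toReal ^ (1 / q.toReal) : ℝ)) : ℂ)‖ₑ ^ q.toReal ≤ h z := by
    rw [← ofReal_norm, Complex.norm_real, Real.norm_of_nonneg (by positivity),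
      ENNReal.ofReal_rpow_of_nonneg (by positivity) hqr.le, ← Real.rpow_mul ENNReal.toReal_nonneg,
      one_div_mul_cancel hqr.ne', Real.rpow_one]
    exact ENNReal.ofReal_toReal_le
  refine (eLpNorm_lt_top_iff_lintegral_rpow_enorm_lt_top hp0 hp).2
    ((lintegral_mono fun x => ?_).trans_lt heint)
  rw [enorm_eq_self, ← ENNReal.rpow_le_rpow_iff (z := q.toReal / p.toReal) (by positivity),
    ← ENNReal.rpow_mul, mul_div_cancel₀ _ hpr.ne', lusin_rpow hq0 hq]
  exact (lintegral_mono hle).trans (hhe x)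

theorem exists_mem_tentSpace_ae_ne_zero [Nonempty X] (hp0 : p ≠ 0) (hp : p ≠ ∞) (hq0 : q ≠ 0)
    (hq : q ≠ ∞) (s : ℝ) : ∃ w : tentSpace μ p q s, ∀ᵐ z ∂halfMeasure μ, (w : L0 μ) z ≠ 0 := by
  obtain ⟨F, hFm, hF0, hF⟩ := exists_eLpNorm_lusin_lt_top μ hp0 hp hq0 hq
  obtain ⟨w, hw⟩ := exists_volPow_ae_eq (μ := μ) (-s) hFm
  refine ⟨⟨w, ?_⟩, ?_⟩
  · change eLpNorm (lusin μ q (volPow μ (-s) w)) p μ < ∞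
    rwa [lusin_congr hw]
  · filter_upwards [hw, ae_halfMeasure_pos μ] with z hz hz0 hwz
    refine hF0 z hz0 ?_
    rw [← hz, volPow, hwz, mul_zero]

end Weight

section Pairing

variable {X : Type*} [MeasurableSpace X] {μ : Measure X} {f g h : L0 μ}

theorem pairing_add_left (hf : Integrable (fun z => f z * conj (g z)) (halfMeasure μ))
    (hh : Integrable (fun z => h z * conj (g z)) (halfMeasure μ)) :
    pairing μ (f + h) g = pairing μ f g + pairing μ h g := by
  refine (integral_congr_ae ?_).trans (integral_add hf hh)
  filter_upwards [AEEqFun.coeFn_add f h] with z hz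
  rw [hz, Pi.add_apply, add_mul]

theorem pairing_smul_left (c : ℂ) (f g : L0 μ) : pairing μ (c • f) g = c * pairing μ f g := by
  refine (integral_congr_ae ?_).trans (integral_const_mul c _)
  filter_upwards [AEEqFun.coeFn_smul c f] with z hz
  rw [hz, Pi.smul_apply, smul_eq_mul, mul_assoc]

theorem pairing_add_right (hg : Integrable (fun z => f z * conj (g z)) (halfMeasure μ))
    (hh : Integrable (fun z => f z * conj (h z)) (halfMeasure μ)) :
    pairing μ f (g + h) = pairing μ f g + pairing μ f h := by
  refine (integral_congr_ae ?_).trans (integral_add hg hh)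
  filter_upwards [AEEqFun.coeFn_add g h] with z hz
  rw [hz, Pi.add_apply, map_add, mul_add]

theorem pairing_smul_right (c : ℂ) (f g : L0 μ) :
    pairing μ f (c • g) = conj c * pairing μ f g := by
  refine (integral_congr_ae ?_).trans (integral_const_mul (conj c) _)
  filter_upwards [AEEqFun.coeFn_smul c g] with z hz
  rw [hz, Pi.smul_apply, smul_eq_mul, map_mul, mul_left_comm]

end Pairing

section KotheDual

variable {X : Type*} [MetricSpace X] [MeasurableSpace X] {μ : Measure X} {p q : ℝ≥0∞} {s : ℝ}
  {f g h : L0 μ} {M M' : ℝ≥0∞}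

/-- `g` satisfies the Köthe bound `M` if `∬ |f g| dμ(x) dt/t ≤ M ‖f‖` for every `f` of finite
`T^{p,q}_s` quasi-norm, that is, if `M` bounds the norm of `g` in the Köthe dual of `T^{p,q}_s`. -/
def KotheBound (p q : ℝ≥0∞) (s : ℝ) (g : L0 μ) (M : ℝ≥0∞) : Prop :=
  ∀ f : L0 μ, tentNorm μ p q s f < ∞ →
    ∫⁻ z, ‖f z‖ₑ * ‖g z‖ₑ ∂halfMeasure μ ≤ M * tentNorm μ p q s f

theorem KotheBound.add (hg : KotheBound p q s g M) (hh : KotheBound p q s h M') :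
    KotheBound p q s (g + h) (M + M') := by
  intro f hf
  calc ∫⁻ z, ‖f z‖ₑ * ‖(g + h) z‖ₑ ∂halfMeasure μ
      ≤ ∫⁻ z, (‖f z‖ₑ * ‖g z‖ₑ + ‖f z‖ₑ * ‖h z‖ₑ) ∂halfMeasure μ := by
        refine lintegral_mono_ae ?_
        filter_upwards [AEEqFun.coeFn_add g h] with z hz
        rw [hz, ← mul_add]
        gcongr
        exact enorm_add_le _ _
    _ = ∫⁻ z, ‖f z‖ₑ * ‖g z‖ₑ ∂halfMeasure μ + ∫⁻ z, ‖f z‖ₑ * ‖h z‖ₑ ∂halfMeasure μ :=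
        lintegral_add_left (f.measurable.enorm.mul g.measurable.enorm) _
    _ ≤ M * tentNorm μ p q s f + M' * tentNorm μ p q s f := add_le_add (hg f hf) (hh f hf)
    _ = (M + M') * tentNorm μ p q s f := (add_mul _ _ _).symm

theorem KotheBound.smul (c : ℂ) (hg : KotheBound p q s g M) :
    KotheBound p q s (c • g) (‖c‖ₑ * M) := by
  intro f hf
  calc ∫⁻ z, ‖f z‖ₑ * ‖(c • g) z‖ₑ ∂halfMeasure μ
      = ∫⁻ z, ‖c‖ₑ * (‖f z‖ₑ * ‖g z‖ₑ) ∂halfMeasure μ := by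
        refine lintegral_congr_ae ?_
        filter_upwards [AEEqFun.coeFn_smul c g] with z hz
        rw [hz, Pi.smul_apply, enorm_smul, mul_left_comm]
    _ = ‖c‖ₑ * ∫⁻ z, ‖f z‖ₑ * ‖g z‖ₑ ∂halfMeasure μ :=
        lintegral_const_mul _ (f.measurable.enorm.mul g.measurable.enorm)
    _ ≤ ‖c‖ₑ * (M * tentNorm μ p q s f) := by gcongr; exact hg f hf
    _ = ‖c‖ₑ * M * tentNorm μ p q s f := (mul_assoc _ _ _).symm

theorem kotheBound_zero : KotheBound p q s (0 : L0 μ) 0 := by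
  intro f _
  rw [zero_mul, nonpos_iff_eq_zero, lintegral_eq_zero_iff' (by fun_prop)]
  filter_upwards [AEEqFun.coeFn_zero (α := X × ℝ) (β := ℂ) (μ := halfMeasure μ)] with z hz
  simp [hz]

variable (μ p q s) in
/-- The Köthe dual of `T^{p,q}_s`: the functions `g` with `∬ |f g| dμ(x) dt/t ≤ M ‖f‖` for some
finite `M` and all `f`. -/
def kotheDual : Submodule ℂ (L0 μ) where
  carrier := {g | ∃ M : ℝ≥0, KotheBound p q s g M}
  add_mem' := by
    rintro g h ⟨M, hg⟩ ⟨M', hh⟩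
    exact ⟨M + M', hg.add hh⟩
  zero_mem' := ⟨0, kotheBound_zero⟩
  smul_mem' := by
    rintro c g ⟨M, hg⟩
    exact ⟨‖c‖₊ * M, hg.smul c⟩

theorem KotheBound.integrable_mul_conj (hg : KotheBound p q s g M) (hM : M ≠ ∞)
    (hf : tentNorm μ p q s f < ∞) : Integrable (fun z => f z * conj (g z)) (halfMeasure μ) := by
  have hm : Measurable fun z => f z * conj (g z) :=
    f.measurable.mul (Complex.continuous_conj.measurable.comp g.measurable)
  refine ⟨hm.aestronglyMeasurable, ?_⟩
  simp only [HasFiniteIntegral, enorm_mul, RCLike.enorm_conj]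
  exact (hg f hf).trans_lt (ENNReal.mul_lt_top hM.lt_top hf)

theorem KotheBound.enorm_pairing_le (hg : KotheBound p q s g M) (hf : tentNorm μ p q s f < ∞) :
    ‖pairing μ f g‖ₑ ≤ M * tentNorm μ p q s f := by
  refine (enorm_integral_le_lintegral_enorm _).trans ?_
  simpa only [enorm_mul, RCLike.enorm_conj] using hg f hf

theorem kotheBound_of_forall_enorm_pairing_le
    (hint : ∀ f, tentNorm μ p q s f < ∞ → Integrable (fun z => f z * conj (g z)) (halfMeasure μ))
    (hM : ∀ f, tentNorm μ p q s f < ∞ → ‖pairing μ f g‖ₑ ≤ M * tentNorm μ p q s f) :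
    KotheBound p q s g M := by
  intro f hf
  refine lintegral_enorm_mul_enorm_le_of_forall_enorm_integral_le (hint f hf) fun k hk => ?_
  have hkf : tentNorm μ p q s k ≤ tentNorm μ p q s f := tentNorm_mono_ae hk
  exact (hM k (hkf.trans_lt hf)).trans (by gcongr)

theorem KotheBound.eq_zero (hg : KotheBound p q s g 0) {w : L0 μ}
    (hw : tentNorm μ p q s w < ∞) (hw0 : ∀ᵐ z ∂halfMeasure μ, w z ≠ 0) : g = 0 := by
  have h := hg w hw
  rw [zero_mul, nonpos_iff_eq_zero, lintegral_eq_zero_iff' (by fun_prop)] at h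
  refine AEEqFun.ext ?_
  filter_upwards [h, hw0, AEEqFun.coeFn_zero (α := X × ℝ) (β := ℂ) (μ := halfMeasure μ)]
    with z hz hwz hzero
  rw [hzero]
  exact enorm_eq_zero.1 ((mul_eq_zero.1 hz).resolve_left (enorm_ne_zero.2 hwz))

variable [BorelSpace X] [hμ : Nondegenerate μ]

theorem integrable_mul_conj_of_mem_kotheDual (hf : f ∈ tentSpace μ p q s)
    (hg : g ∈ kotheDual μ p q s) : Integrable (fun z => f z * conj (g z)) (halfMeasure μ) :=
  let ⟨_, hM⟩ := hg
  hM.integrable_mul_conj ENNReal.coe_ne_top hf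

variable (μ p q s) in
/-- The map `g ↦ ⟨·, g⟩` from the Köthe dual of `T^{p,q}_s` to the dual of `T^{p,q}_s`. -/
noncomputable def pairingMap : kotheDual μ p q s →ₛₗ[starRingEnd ℂ] tentDual μ p q s where
  toFun g :=
    ⟨{ toFun := fun f => pairing μ f g
       map_add' := fun f k => pairing_add_left (integrable_mul_conj_of_mem_kotheDual f.2 g.2)
        (integrable_mul_conj_of_mem_kotheDual k.2 g.2)
       map_smul' := fun c f => pairing_smul_left c (f : L0 μ) (g : L0 μ) },
      let ⟨M, hM⟩ := g.2
      ⟨M, fun f => hM.enorm_pairing_le f.2⟩⟩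
  map_add' g h := Subtype.ext (LinearMap.ext fun f =>
    pairing_add_right (integrable_mul_conj_of_mem_kotheDual f.2 g.2)
      (integrable_mul_conj_of_mem_kotheDual f.2 h.2))
  map_smul' c g := Subtype.ext (LinearMap.ext fun f => pairing_smul_right c (f : L0 μ) (g : L0 μ))

theorem enorm_le_dualNorm_mul_tentNorm (φ : tentDual μ p q s) (f : tentSpace μ p q s) :
    ‖(φ : Module.Dual ℂ (tentSpace μ p q s)) f‖ₑ ≤ dualNorm φ * tentNorm μ p q s f := by
  have hfin : tentNorm μ p q s f ≠ ∞ := f.2.ne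
  rcases eq_or_ne (tentNorm μ p q s f) 0 with h0 | h0
  · obtain ⟨C, hC⟩ := φ.2
    refine (hC f).trans ?_
    rw [h0, mul_zero, mul_zero]
  set c : ℂ := ((tentNorm μ p q s f).toReal : ℂ)
  have hce : ‖c‖ₑ = tentNorm μ p q s f := by
    rw [← ofReal_norm, Complex.norm_real, Real.norm_of_nonneg ENNReal.toReal_nonneg,
      ENNReal.ofReal_toReal hfin]
  have hc0 : c ≠ 0 := enorm_ne_zero.1 (hce ▸ h0)
  have hle : tentNorm μ p q s ((c⁻¹ • f : tentSpace μ p q s) : L0 μ) ≤ 1 := by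
    refine (tentNorm_smul_le p q s _ _).trans ?_
    rw [enorm_inv hc0, hce, ENNReal.inv_mul_cancel h0 hfin]
  have hφ : ‖(φ : Module.Dual ℂ (tentSpace μ p q s)) (c⁻¹ • f)‖ₑ ≤ dualNorm φ :=
    le_iSup₂ (f := fun (f : tentSpace μ p q s) (_ : tentNorm μ p q s f ≤ 1) =>
      ‖(φ : Module.Dual ℂ (tentSpace μ p q s)) f‖ₑ) _ hle
  calc ‖(φ : Module.Dual ℂ (tentSpace μ p q s)) f‖ₑ
      = ‖(φ : Module.Dual ℂ (tentSpace μ p q s)) (c • c⁻¹ • f)‖ₑ := by rw [smul_inv_smul₀ hc0]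
    _ = tentNorm μ p q s f * ‖(φ : Module.Dual ℂ (tentSpace μ p q s)) (c⁻¹ • f)‖ₑ := by
        rw [map_smul, enorm_smul, hce]
    _ ≤ dualNorm φ * tentNorm μ p q s f := by
        rw [mul_comm]
        gcongr

theorem dualNorm_pairingMap_le {g : kotheDual μ p q s} (hg : KotheBound p q s (g : L0 μ) M) :
    dualNorm (pairingMap μ p q s g) ≤ M :=
  iSup₂_le fun f hf => (hg.enorm_pairing_le f.2).trans (mul_le_of_le_one_right zero_le hf)

theorem kotheBound_dualNorm_pairingMap (g : kotheDual μ p q s) :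
    KotheBound p q s (g : L0 μ) (dualNorm (pairingMap μ p q s g)) :=
  kotheBound_of_forall_enorm_pairing_le
    (fun _ hf => integrable_mul_conj_of_mem_kotheDual hf g.2)
    fun f hf => enorm_le_dualNorm_mul_tentNorm (pairingMap μ p q s g) ⟨f, hf⟩

variable [Nonempty X]

theorem pairingMap_injective (hp0 : p ≠ 0) (hp : p ≠ ∞) (hq0 : q ≠ 0) (hq : q ≠ ∞) :
    Function.Injective (pairingMap μ p q s) := by
  refine (injective_iff_map_eq_zero _).2 fun g hg => Subtype.ext ?_
  obtain ⟨w, hw⟩ := exists_mem_tentSpace_ae_ne_zero μ hp0 hp hq0 hq s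
  refine KotheBound.eq_zero ?_ w.2 hw
  have hnorm : dualNorm (pairingMap μ p q s g) = 0 := by
    simp [hg, dualNorm]
  exact hnorm ▸ kotheBound_dualNorm_pairingMap g

theorem pairingMap_surjective (hp0 : p ≠ 0) (hp : p ≠ ∞) (hq0 : q ≠ 0) (hq : q ≠ ∞) :
    Function.Surjective (pairingMap μ p q s) := by
  intro φ
  have := sigmaFinite_halfMeasure μ
  obtain ⟨w, hw⟩ := exists_mem_tentSpace_ae_ne_zero μ hp0 hp hq0 hq s
  obtain ⟨g, hg⟩ := (isOrderContinuous_of_mem_tentDual hp0 hp hq φ).exists_forall_eq_integral_mul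
    (isSolid_tentSpace s) hw
  have hconj (f : L0 μ) : (fun z => f z * g z) =ᵐ[halfMeasure μ]
      fun z => f z * conj (star g z) := by
    filter_upwards [AEEqFun.coeFn_star g] with z hz
    rw [hz, Pi.star_apply, RCLike.star_def, Complex.conj_conj]
  have hpair (f : tentSpace μ p q s) :
      (φ : Module.Dual ℂ (tentSpace μ p q s)) f = pairing μ f (star g) :=
    (hg f).2.trans (integral_congr_ae (hconj f))
  obtain ⟨C, hC⟩ := φ.2
  have hbound : KotheBound p q s (star g) C :=
    kotheBound_of_forall_enorm_pairing_le (fun f hf => (hg ⟨f, hf⟩).1.congr (hconj f))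
      fun f hf => hpair ⟨f, hf⟩ ▸ hC ⟨f, hf⟩
  exact ⟨⟨star g, C, hbound⟩, Subtype.ext (LinearMap.ext fun f => (hpair f).symm)⟩

end KotheDual

section CarlesonSpace

variable {X : Type*} [MetricSpace X] [MeasurableSpace X] {μ : Measure X} [hμ : Nondegenerate μ]
  {p q q' : ℝ≥0∞} {s : ℝ} {g : L0 μ} {M : ℝ≥0∞}

theorem carlesonNorm_le_iff_forall_ball {α : ℝ} :
    carlesonNorm μ q s α g ≤ M ↔ ∀ (c : X) (r : ℝ), 0 < r →
      μ (ball c r) ^ (-α) * eLpNorm (volPow μ (-s) g) q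
        ((μ (ball c r))⁻¹ • (halfMeasure μ).restrict (tent (ball c r))) ≤ M := by
  refine ⟨fun h c r hr => ?_, fun h => essSup_le_of_ae_le _ (.of_forall fun x => ?_)⟩
  · have hae : ∀ᵐ x ∂μ, carleson μ q α (volPow μ (-s) g) x ≤ M :=
      (enorm_ae_le_eLpNormEssSup (carleson μ q α (volPow μ (-s) g)) μ).mono fun _ hx => hx.trans h
    obtain ⟨x, hx, hxM⟩ : ∃ x ∈ ball c r, carleson μ q α (volPow μ (-s) g) x ≤ M := by
      by_contra! hlt
      exact (hμ.pos c r hr).ne' (measure_mono_null (fun x hx => not_le.2 (hlt x hx)) hae)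
    refine le_trans ?_ hxM
    exact le_iSup_of_le c (le_iSup_of_le r (le_iSup_of_le hr (le_iSup_of_le hx le_rfl)))
  · exact iSup_le fun c => iSup_le fun r => iSup_le fun hr => iSup_le fun _ => h c r hr

theorem carlesonNorm_delta_le_iff [ENNReal.HolderConjugate q q'] :
    carlesonNorm μ q' (-s) (delta 1 p) g ≤ M ↔ ∀ (c : X) (r : ℝ), 0 < r →
      eLpNorm (volPow μ s g) q' ((halfMeasure μ).restrict (tent (ball c r))) ≤
        M * μ (ball c r) ^ (1 / p.toReal - 1 / q.toReal) := by
  rw [carlesonNorm_le_iff_forall_ball, neg_neg]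
  refine forall_congr' fun c => forall_congr' fun r => forall_congr' fun hr => ?_
  have h0 : μ (ball c r) ≠ 0 := (hμ.pos c r hr).ne'
  have h1 : μ (ball c r) ≠ ∞ := (hμ.lt_top c r hr).ne
  have hexp : -delta 1 p + -(1 / q').toReal = -(1 / p.toReal - 1 / q.toReal) := by
    have hq := congrArg ENNReal.toReal (ENNReal.HolderConjugate.inv_add_inv_eq_one q q')
    rw [ENNReal.toReal_add (by simpa using ENNReal.HolderConjugate.ne_zero q q')
      (by simpa using ENNReal.HolderConjugate.ne_zero q' q)] at hq
    simp only [delta, one_div, ENNReal.toReal_inv, ENNReal.toReal_one, inv_one] at hq ⊢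
    linarith
  rw [eLpNorm_smul_measure_of_ne_zero (ENNReal.inv_ne_zero.2 h1), smul_eq_mul, ← mul_assoc,
    ENNReal.inv_rpow, ← ENNReal.rpow_neg, ← ENNReal.rpow_add _ _ h0 h1, hexp, ENNReal.rpow_neg,
    ← ENNReal.div_eq_inv_mul, ENNReal.div_le_iff (ENNReal.rpow_pos (pos_iff_ne_zero.2 h0) h1).ne'
      (ENNReal.rpow_ne_top_of_ne_zero h0 h1)]

variable [BorelSpace X]

theorem KotheBound.lintegral_enorm_mul_enorm_volPow_le (hg : KotheBound p q s g M)
    {F : X × ℝ → ℂ} (hF : Measurable F) (hfin : eLpNorm (lusin μ q F) p μ < ∞) :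
    ∫⁻ z, ‖F z‖ₑ * ‖volPow μ s g z‖ₑ ∂halfMeasure μ ≤ M * eLpNorm (lusin μ q F) p μ := by
  obtain ⟨f, hf⟩ := exists_volPow_ae_eq (μ := μ) (-s) hF
  have hnorm : tentNorm μ p q s f = eLpNorm (lusin μ q F) p μ := by rw [tentNorm, lusin_congr hf]
  calc ∫⁻ z, ‖F z‖ₑ * ‖volPow μ s g z‖ₑ ∂halfMeasure μ
      = ∫⁻ z, ‖volPow μ (-s) f z‖ₑ * ‖volPow μ s g z‖ₑ ∂halfMeasure μ :=
        lintegral_congr_ae (by filter_upwards [hf] with z hz; rw [hz])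
    _ = ∫⁻ z, ‖f z‖ₑ * ‖g z‖ₑ ∂halfMeasure μ :=
        lintegral_enorm_volPow_neg_mul_enorm_volPow s f g
    _ ≤ M * eLpNorm (lusin μ q F) p μ := hnorm ▸ hg f (hnorm ▸ hfin)

theorem KotheBound.carlesonNorm_le [ENNReal.HolderConjugate q q'] (hpq : p ≤ q) (hq : q ≠ ∞)
    (hg : KotheBound p q s g M) : carlesonNorm μ q' (-s) (delta 1 p) g ≤ M := by
  have := sigmaFinite_halfMeasure μ
  refine (carlesonNorm_delta_le_iff (q := q)).2 fun c r hr => ?_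
  set T := tent (ball c r)
  have hT : MeasurableSet T := measurableSet_tent μ (ball c r)
  refine eLpNorm_le_of_forall_lintegral_mul_le hq
    (measurable_volPow s g.measurable).stronglyMeasurable fun f hf hfin => ?_
  set F : X × ℝ → ℂ := T.indicator fun z => ((f z : ℝ) : ℂ)
  have hF : Measurable F := (Complex.measurable_ofReal.comp hf.coe_nnreal_real).indicator hT
  have hFf (z : X × ℝ) : ‖((f z : ℝ) : ℂ)‖ₑ = f z := by simp [← ofReal_norm]
  have hnorm : eLpNorm F q (halfMeasure μ) = eLpNorm f q ((halfMeasure μ).restrict T) :=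
    (eLpNorm_indicator_eq_eLpNorm_restrict hT).trans (eLpNorm_congr_enorm_ae (.of_forall hFf))
  have hlusin : eLpNorm (lusin μ q F) p μ ≤
      eLpNorm f q ((halfMeasure μ).restrict T) * μ (ball c r) ^ (1 / p.toReal - 1 / q.toReal) :=
    hnorm ▸ eLpNorm_lusin_le_of_support_subset_tent hpq (ENNReal.HolderConjugate.ne_zero q q') hq
      hF support_indicator_subset
  have hpow : μ (ball c r) ^ (1 / p.toReal - 1 / q.toReal) < ∞ :=
    (ENNReal.rpow_ne_top_of_ne_zero (hμ.pos c r hr).ne' (hμ.lt_top c r hr).ne).lt_top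
  calc ∫⁻ z in T, f z * ‖volPow μ s g z‖ₑ ∂halfMeasure μ
      = ∫⁻ z, ‖F z‖ₑ * ‖volPow μ s g z‖ₑ ∂halfMeasure μ := by
        rw [← lintegral_indicator hT]
        congr 1 with z
        by_cases hz : z ∈ T <;> simp [F, hz, hFf]
    _ ≤ M * eLpNorm (lusin μ q F) p μ :=
        hg.lintegral_enorm_mul_enorm_volPow_le hF (hlusin.trans_lt (ENNReal.mul_lt_top hfin hpow))
    _ ≤ M * μ (ball c r) ^ (1 / p.toReal - 1 / q.toReal) *
          eLpNorm f q ((halfMeasure μ).restrict T) := by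
        rw [mul_assoc, mul_comm (μ (ball c r) ^ _)]
        gcongr

theorem exists_forall_kotheBound_carlesonNorm (hD : Doubling μ) [ENNReal.HolderConjugate q q']
    (hp0 : p ≠ 0) (hp1 : p ≤ 1) (hq : q ≠ ∞) (s : ℝ) :
    ∃ C : ℝ≥0, ∀ g : L0 μ, KotheBound p q s g (C * carlesonNorm μ q' (-s) (delta 1 p) g) := by
  obtain ⟨D, hD⟩ := hD.exists_measure_ball_five_mul_le
  set K : ℝ≥0∞ := 4 * (2 * D) ^ (1 / p.toReal) * (1 - 2 ^ (-p.toReal))⁻¹ ^ (1 / p.toReal)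
  have hr : 0 < p.toReal := ENNReal.toReal_pos hp0 (ne_top_of_le_ne_top ENNReal.one_ne_top hp1)
  have hlt : (2 : ℝ≥0∞) ^ (-p.toReal) < 1 :=
    ENNReal.rpow_lt_one_of_one_lt_of_neg ENNReal.one_lt_two (neg_neg_of_pos hr)
  have hK : K ≠ ∞ := by
    have hinv : (1 - (2 : ℝ≥0∞) ^ (-p.toReal))⁻¹ ≠ ∞ :=
      ENNReal.inv_ne_top.2 (tsub_pos_of_lt hlt).ne'
    finiteness
  refine ⟨K.toNNReal, fun g f hf => ?_⟩
  rw [ENNReal.coe_toNNReal hK, ← lintegral_enorm_volPow_neg_mul_enorm_volPow s]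
  exact lintegral_enorm_mul_enorm_le_eLpNorm_lusin hD hq (measurable_volPow (-s) f.measurable)
    (measurable_volPow s g.measurable) hp0 hp1 ((carlesonNorm_delta_le_iff (q := q)).1 le_rfl) hf

theorem carlesonSpace_eq_kotheDual (hD : Doubling μ) [ENNReal.HolderConjugate q q']
    (hp0 : p ≠ 0) (hp1 : p ≤ 1) (hq : q ≠ ∞) (s : ℝ) :
    carlesonSpace μ q' (-s) (delta 1 p) = kotheDual μ p q s := by
  obtain ⟨C, hC⟩ := exists_forall_kotheBound_carlesonNorm hD hp0 hp1 hq s (q' := q')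
  ext g
  refine ⟨fun hg => ⟨(C * carlesonNorm μ q' (-s) (delta 1 p) g).toNNReal, ?_⟩, fun ⟨M, hM⟩ =>
    (hM.carlesonNorm_le (hp1.trans (ENNReal.HolderConjugate.one_le q q')) hq).trans_lt
      ENNReal.coe_lt_top⟩
  rw [ENNReal.coe_toNNReal (ENNReal.mul_ne_top ENNReal.coe_ne_top (LT.lt.ne hg))]
  exact hC g

end CarlesonSpace

end TentSpace

theorem mainTheorem5_general {X : Type*} [MetricSpace X] [Nonempty X] [MeasurableSpace X]
    [BorelSpace X] (μ : Measure X) [Nondegenerate μ] (hμ : Doubling μ) (p q q' : ℝ≥0∞)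
    (hp0 : p ≠ 0) (hp1 : p ≤ 1) (hq : q ≠ ∞) [ENNReal.HolderConjugate q q'] (s : ℝ) :
    (∀ f ∈ tentSpace μ p q s, ∀ g ∈ carlesonSpace μ q' (-s) (delta 1 p),
      Integrable (fun z => f z * conj (g z)) (halfMeasure μ)) ∧
    ∃ Φ : carlesonSpace μ q' (-s) (delta 1 p) ≃ₛₗ[starRingEnd ℂ] tentDual μ p q s,
      (∀ (g : carlesonSpace μ q' (-s) (delta 1 p)) (f : tentSpace μ p q s),
        (Φ g : Module.Dual ℂ (tentSpace μ p q s)) f = pairing μ f g) ∧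
      ∃ C : ℝ≥0, ∀ g : carlesonSpace μ q' (-s) (delta 1 p),
        dualNorm (Φ g) ≤ C * carlesonNorm μ q' (-s) (delta 1 p) g ∧
        carlesonNorm μ q' (-s) (delta 1 p) g ≤ C * dualNorm (Φ g) := by
  rw [carlesonSpace_eq_kotheDual hμ hp0 hp1 hq s]
  have hp : p ≠ ∞ := ne_top_of_le_ne_top ENNReal.one_ne_top hp1
  have hq0 : q ≠ 0 := ENNReal.HolderConjugate.ne_zero q q'
  have hpq : p ≤ q := hp1.trans (ENNReal.HolderConjugate.one_le q q')
  obtain ⟨C, hC⟩ := exists_forall_kotheBound_carlesonNorm hμ hp0 hp1 hq s (q' := q')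
  refine ⟨fun f hf g hg => integrable_mul_conj_of_mem_kotheDual hf hg,
    .ofBijective (pairingMap μ p q s)
      ⟨pairingMap_injective hp0 hp hq0 hq, pairingMap_surjective hp0 hp hq0 hq⟩,
    fun _ _ => rfl, max C 1, fun g => ⟨?_, ?_⟩⟩
  · refine (dualNorm_pairingMap_le (hC g)).trans ?_
    gcongr
    exact le_max_left C 1
  · refine ((kotheBound_dualNorm_pairingMap g).carlesonNorm_le hpq hq).trans ?_
    exact le_mul_of_one_le_left zero_le (ENNReal.coe_le_coe.2 (le_max_right C 1))

theorem mainTheorem5 {X : Type*} [MetricSpace X] [Nonempty X] [MeasurableSpace X] [BorelSpace X]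
    (μ : Measure X) [Nondegenerate μ] (hμ : Doubling μ)
    (p q q' : ℝ≥0∞) (hp0 : 0 < p) (hp1 : p < 1) (hq1 : 1 ≤ q) (hq : q < ∞)
    (hqq' : 1 / q + 1 / q' = 1) (s : ℝ) :
    (∀ f ∈ tentSpace μ p q s, ∀ g ∈ carlesonSpace μ q' (-s) (delta 1 p),
      Integrable (fun z => f z * conj (g z)) (halfMeasure μ)) ∧
    ∃ Φ : carlesonSpace μ q' (-s) (delta 1 p) ≃ₛₗ[starRingEnd ℂ] tentDual μ p q s,
      (∀ (g : carlesonSpace μ q' (-s) (delta 1 p)) (f : tentSpace μ p q s),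
        (Φ g : Module.Dual ℂ (tentSpace μ p q s)) f = pairing μ f g) ∧
      ∃ C : ℝ≥0, ∀ g : carlesonSpace μ q' (-s) (delta 1 p),
        dualNorm (Φ g) ≤ C * carlesonNorm μ q' (-s) (delta 1 p) g ∧
        carlesonNorm μ q' (-s) (delta 1 p) g ≤ C * dualNorm (Φ g) := by
  have := ENNReal.holderConjugate_iff.2 (by simpa only [one_div] using hqq')
  exact mainTheorem5_general μ hμ p q q' hp0.ne' hp1.le hq.ne s
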